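/- Let $a<b$, let $(\Omega,\mathcal F,\mathbb P)$ be a probability space, and let $u:[a,b]\times\Omega\to\mathbb R$ be a Gaussian random field with spatial correlation function $R(x,y)=\mathbb E\big((u(x)-\mathbb Eu(x))(u(y)-\mathbb Eu(y))\big)$, and write $R_{k,\ell}(x)=\frac{\partial^{k+\ell}R}{\partial x^k\partial y^\ell}(x,x)$ (derivatives at end points of $[a,b]$ are one-sided). Assume: (G1) $u(\cdot,\omega)$ is twice continuously differentiable on $[a,b]$ for $\mathbb P$-almost all $\omega$, and $\mathbb E u(x)=0$ for every $x\in[a,b]$. (G2) $R$ is three times continuously differentiable in each of its two variables in a neighborhood of the diagonal (that is, the partial derivatives $\partial_x^k\partial_y^\ell R$, $0\le k,\ell\le 3$, exist and are continuous on the part of $[a,b]^2$ in an open set containing the diagonal), and the matrix $$\mathcal R(x)=\begin{pmatrix}R_{0,0}(x)&R_{1,0}(x)&R_{2,0}(x)\\R_{1,0}(x)&R_{1,1}(x)&R_{2,1}(x)\\R_{2,0}(x)&R_{2,1}(x)&R_{2,2}(x)\end{pmatrix}$$ is positive definite for every $x\in[a,b]$. Put $\mathcal R^m_{33}=R_{0,0}R_{1,1}-R_{1,0}^2$,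 $\mathcal R^m_{32}=R_{0,0}R_{2,1}-R_{1,0}R_{2,0}$, $\mathcal R^m_{31}=R_{1,0}R_{2,1}-R_{1,1}R_{2,0}$. Fix $x\in[a,b)$ and, for sufficiently small $\delta>0$, let $T(\delta)=(u(x),u(x+\delta/2),u(x+\delta))^t$. Then, for all sufficiently small $\delta>0$, $T(\delta)$ is a centered Gaussian random vector with positive definite covariance matrix $C(\delta)$. Let $0<\lambda_1(\delta)\le\lambda_2(\delta)\le\lambda_3(\delta)$ be the eigenvalues of $C(\delta)$. As $\delta\to0^+$, $$\lambda_1(\delta)=\frac{\det\mathcal R(x)}{96\,\mathcal R^m_{33}(x)}\,\delta^4+O(\delta^5),\qquad \lambda_2(\delta)=\frac{\mathcal R^m_{33}(x)}{2R_{0,0}(x)}\,\delta^2+O(\delta^3),\qquad \lambda_3(\delta)=3R_{0,0}(x)+O(\delta).$$ Corresponding orthonormal eigenvectors $v_1(\delta),v_2(\delta),v_3(\delta)$ can be chosen such that, as $\delta\to0^+$, $$v_1(\delta)\to\tfrac1{\sqrt6}(1,-2,1)^t,\qquad v_2(\delta)\to\tfrac1{\sqrt2}(1,0,-1)^t,\qquad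 v_3(\delta)\to\tfrac1{\sqrt3}(1,1,1)^t,$$ and such that for every $C^3$-function $\mu:[a,b]\to\mathbb R$, the vector $\tau(\delta)=(\mu(x),\mu(x+\delta/2),\mu(x+\delta))^t$ satisfies, as $\delta\to0^+$, $$\tau(\delta)\cdot v_1(\delta)=\frac{\mathcal R^m_{31}(x)\mu(x)-\mathcal R^m_{32}(x)\mu'(x)+\mathcal R^m_{33}(x)\mu''(x)}{4\sqrt6\,\mathcal R^m_{33}(x)}\,\delta^2+O(\delta^3),$$ $$\tau(\delta)\cdot v_2(\delta)=\frac{R_{1,0}(x)\mu(x)-R_{0,0}(x)\mu'(x)}{\sqrt2\,R_{0,0}(x)}\,\delta+O(\delta^2),\qquad \tau(\delta)\cdot v_3(\delta)=\sqrt3\,\mu(x)+O(\delta).$$ -/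

import Mathlib

open Set Filter Topology MeasureTheory ProbabilityTheory Asymptotics

noncomputable section

namespace CorrSamp

/-- The spatial correlation function
`R(x,y) = 𝔼((u(x) - 𝔼u(x)) (u(y) - 𝔼u(y)))` of a random field `u`. -/
def corr {Ω : Type*} [MeasurableSpace Ω] (P : Measure Ω) (u : ℝ → Ω → ℝ) (x y : ℝ) : ℝ :=
  cov[u x, u y; P]

/-- `R_{k,l}(x) = (∂^{k+l} R / ∂x^k ∂y^l)(x,x)` for a function `R` on `[a,b]²`; at the end points
of `[a,b]` the derivatives are one-sided. -/
def diagDeriv (a b : ℝ) (R : ℝ → ℝ → ℝ) (k l : ℕ) (x : ℝ) : ℝ :=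
  iteratedDerivWithin k (fun s => iteratedDerivWithin l (fun t => R s t) (Icc a b) x) (Icc a b) x

/-- The function `R` on `[a,b]²` is `n` times continuously differentiable in each of its two
variables in a neighborhood of the diagonal: the partial derivatives
`D k l = ∂^{k+l} R / ∂x^k ∂y^l`, `0 ≤ k, l ≤ n`, exist and are continuous on `U ∩ [a,b]²` for some
open set `U` containing the diagonal of `[a,b]²`. -/
def IsSmoothNearDiag (n : ℕ) (a b : ℝ) (R : ℝ → ℝ → ℝ) : Prop :=
  ∃ (U : Set (ℝ × ℝ)) (D : ℕ → ℕ → ℝ → ℝ → ℝ),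
    IsOpen U ∧ (∀ x ∈ Icc a b, (x, x) ∈ U) ∧
    (∀ x ∈ Icc a b, ∀ y ∈ Icc a b, (x, y) ∈ U → D 0 0 x y = R x y) ∧
    (∀ k < n, ∀ l ≤ n, ∀ x ∈ Icc a b, ∀ y ∈ Icc a b, (x, y) ∈ U →
      HasDerivWithinAt (fun s => D k l s y) (D (k + 1) l x y) (Icc a b) x) ∧
    (∀ k ≤ n, ∀ l < n, ∀ x ∈ Icc a b, ∀ y ∈ Icc a b, (x, y) ∈ U →
      HasDerivWithinAt (fun t => D k l x t) (D k (l + 1) x y) (Icc a b) y) ∧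
    (∀ k ≤ n, ∀ l ≤ n,
      ContinuousOn (fun p : ℝ × ℝ => D k l p.1 p.2) (U ∩ Icc a b ×ˢ Icc a b))

/-- The matrix `𝓡(x)` of derivatives of `R` on the diagonal. -/
def corrMatrix (a b : ℝ) (R : ℝ → ℝ → ℝ) (x : ℝ) : Matrix (Fin 3) (Fin 3) ℝ :=
  !![diagDeriv a b R 0 0 x, diagDeriv a b R 1 0 x, diagDeriv a b R 2 0 x;
     diagDeriv a b R 1 0 x, diagDeriv a b R 1 1 x, diagDeriv a b R 2 1 x;
     diagDeriv a b R 2 0 x, diagDeriv a b R 2 1 x, diagDeriv a b R 2 2 x]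

/-- `𝓡^m_{33} = R_{0,0} R_{1,1} - R_{1,0}²`. -/
def minor33 (a b : ℝ) (R : ℝ → ℝ → ℝ) (x : ℝ) : ℝ :=
  diagDeriv a b R 0 0 x * diagDeriv a b R 1 1 x - diagDeriv a b R 1 0 x ^ 2

/-- `𝓡^m_{32} = R_{0,0} R_{2,1} - R_{1,0} R_{2,0}`. -/
def minor32 (a b : ℝ) (R : ℝ → ℝ → ℝ) (x : ℝ) : ℝ :=
  diagDeriv a b R 0 0 x * diagDeriv a b R 2 1 x - diagDeriv a b R 1 0 x * diagDeriv a b R 2 0 x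

/-- `𝓡^m_{31} = R_{1,0} R_{2,1} - R_{1,1} R_{2,0}`. -/
def minor31 (a b : ℝ) (R : ℝ → ℝ → ℝ) (x : ℝ) : ℝ :=
  diagDeriv a b R 1 0 x * diagDeriv a b R 2 1 x - diagDeriv a b R 1 1 x * diagDeriv a b R 2 0 x

/-- Assumption (G1): on `[a,b]`, the random field `u` is Gaussian, centered, and almost surely has
twice continuously differentiable sample paths. Values of `u` off `[a,b]` play no role. -/
structure G1 {Ω : Type*} [MeasurableSpace Ω] (P : Measure Ω) (a b : ℝ) (u : ℝ → Ω → ℝ) :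
    Prop where
  gaussian : IsGaussianProcess (fun t : Icc a b => u t) P
  paths : ∀ᵐ ω ∂P, ContDiffOn ℝ 2 (fun t => u t ω) (Icc a b)
  centered : ∀ t ∈ Icc a b, ∫ ω, u t ω ∂P = 0

/-- Assumption (G2): the spatial correlation function is three times continuously differentiable
(in each variable) near the diagonal, and `𝓡(x)` is positive definite for all `x ∈ [a,b]`. -/
structure G2 {Ω : Type*} [MeasurableSpace Ω] (P : Measure Ω) (a b : ℝ) (u : ℝ → Ω → ℝ) :
    Prop where
  smooth : IsSmoothNearDiag 3 a b (corr P u)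
  posDef : ∀ x ∈ Icc a b, (corrMatrix a b (corr P u) x).PosDef

/-- The vector `(f(x), f(x + δ/2), f(x + δ))`. -/
def sample (f : ℝ → ℝ) (x δ : ℝ) : EuclideanSpace ℝ (Fin 3) :=
  !₂[f x, f (x + δ / 2), f (x + δ)]

/-- The random vector `T(δ) = (u(x), u(x + δ/2), u(x + δ))`. -/
def T {Ω : Type*} (u : ℝ → Ω → ℝ) (x δ : ℝ) (ω : Ω) : EuclideanSpace ℝ (Fin 3) :=
  sample (fun t => u t ω) x δ

/-- The covariance matrix of a random vector in `ℝ³`. -/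
def covMatrix {Ω : Type*} [MeasurableSpace Ω] (P : Measure Ω)
    (X : Ω → EuclideanSpace ℝ (Fin 3)) : Matrix (Fin 3) (Fin 3) ℝ :=
  Matrix.of fun i j => cov[fun ω => X ω i, fun ω => X ω j; P]

theorem covMatrix_isHermitian {Ω : Type*} [MeasurableSpace Ω] (P : Measure Ω)
    (X : Ω → EuclideanSpace ℝ (Fin 3)) : (covMatrix P X).IsHermitian := by
  ext i j
  simp [covMatrix, covariance_comm]

/-- The eigenvalues, counted with multiplicity, of the covariance matrix of a random vector in
`ℝ³`, in increasing order: indices `0, 1, 2` give `λ₁ ≤ λ₂ ≤ λ₃`. (Mathlib's `eigenvalues₀` lists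
them in decreasing order.) -/
def covEigenvalue {Ω : Type*} [MeasurableSpace Ω] (P : Measure Ω)
    (X : Ω → EuclideanSpace ℝ (Fin 3)) (k : Fin 3) : ℝ :=
  (covMatrix_isHermitian P X).eigenvalues₀ (Fin.cast (Fintype.card_fin 3).symm (Fin.rev k))

end CorrSamp

end

/-! Put h = δ/2. Newton interpolation expresses the samples of f at x, x + h, x + 2h as A times the
divided differences of f, where A has rows (1, 0, 0), (1, h, 0), (1, 2h, h²). Applied in both
variables of the correlation this gives the exact factorization C(δ) = A M(δ) Aᵀ (`covMatrix_T_eq`),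
with M(δ) the symmetric matrix of mixed divided differences. By the mean value theorem and
boundedness of third derivatives, M(δ) = 𝓡(x) + O(δ) (`isOrder_divDiff₂_sub`), so the singular
behaviour sits in the explicit A.

Eigenvalues: the elementary symmetric functions of C are e₁ = 3 R₀₀ + O(δ), e₂ = (3/2) 𝓡ᵐ₃₃ δ² +
O(δ³) and e₃ = (det A)² det M = (δ⁶/64) det 𝓡 + O(δ⁷). Since the eigenvalues are positive and
ordered, λ₃, λ₂λ₃ and λ₁λ₂λ₃ dominate these in turn, and division yields the three expansions
(`isOrder_of_esymm`).

Eigenvectors: for a unit eigenvector v put w = Aᵀ v, so that A M w = λ v. Taking differences of rows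
bounds the first components of M w by λ over powers of δ; solving these equations gives w, hence the
direction of v, and the norm with a sign choice fixes v (`IsEigenpair.smallest`,
`IsEigenpair.middle`, `IsEigenpair.largest`).

Projections: τ = A d with d the divided differences of μ, so τ · v = d · w, and the expansions of d
and w multiply (`inner_sample`). -/

noncomputable section

namespace CorrSamp

/-! ### Calculus of orders in δ -/

/-- `f(δ) = O(δ ^ n)` as `δ → 0⁺`. -/
def IsOrder (n : ℕ) (f : ℝ → ℝ) : Prop := f =O[𝓝[>] 0] fun δ => δ ^ n

namespace IsOrder

variable {f g : ℝ → ℝ} {m n : ℕ}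

theorem congr (hf : IsOrder n f) (h : ∀ᶠ δ in 𝓝[>] (0 : ℝ), f δ = g δ) : IsOrder n g :=
  IsBigO.congr' hf h (EventuallyEq.refl _ _)

theorem congr_pos (hf : IsOrder n f) (h : ∀ δ : ℝ, 0 < δ → f δ = g δ) : IsOrder n g :=
  hf.congr (by filter_upwards [self_mem_nhdsWithin] with δ hδ using h δ hδ)

theorem add (hf : IsOrder n f) (hg : IsOrder n g) : IsOrder n fun δ => f δ + g δ :=
  IsBigO.add hf hg

theorem sub (hf : IsOrder n f) (hg : IsOrder n g) : IsOrder n fun δ => f δ - g δ :=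
  IsBigO.sub hf hg

theorem mul (hf : IsOrder m f) (hg : IsOrder n g) : IsOrder (m + n) fun δ => f δ * g δ :=
  (IsBigO.mul hf hg).congr_right fun δ => (pow_add δ m n).symm

theorem const_mul (c : ℝ) (hf : IsOrder n f) : IsOrder n fun δ => c * f δ :=
  IsBigO.const_mul_left hf c

theorem const (c : ℝ) : IsOrder 0 fun _ => c := by
  simpa [IsOrder] using isBigO_const_const c (one_ne_zero (α := ℝ)) (𝓝[>] (0 : ℝ))

theorem pow (n : ℕ) : IsOrder n fun δ => δ ^ n := isBigO_refl _ _

theorem id : IsOrder 1 fun δ => δ := (pow 1).congr_pos fun δ _ => pow_one δ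

theorem mono (hf : IsOrder n f) (h : m ≤ n) : IsOrder m f := by
  refine IsBigO.trans hf (IsBigO.of_bound 1 ?_)
  filter_upwards [Ioo_mem_nhdsGT (zero_lt_one (α := ℝ))] with δ hδ
  have := pow_le_pow_of_le_one hδ.1.le hδ.2.le h
  rwa [one_mul, Real.norm_of_nonneg (pow_nonneg hδ.1.le _),
    Real.norm_of_nonneg (pow_nonneg hδ.1.le _)]

theorem of_abs_le {K : ℝ} (h : ∀ᶠ δ in 𝓝[>] (0 : ℝ), |f δ| ≤ K * δ ^ n) : IsOrder n f := by
  refine IsBigO.of_bound K ?_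
  filter_upwards [h, self_mem_nhdsWithin] with δ h hδ
  rwa [Real.norm_eq_abs, Real.norm_of_nonneg (pow_nonneg (le_of_lt hδ) _)]

theorem of_abs_le_abs (hg : IsOrder n g) (h : ∀ᶠ δ in 𝓝[>] (0 : ℝ), |f δ| ≤ |g δ|) :
    IsOrder n f :=
  (IsBigO.of_bound 1 (by simpa using h)).trans hg

theorem cancel (h : IsOrder (m + n) fun δ => δ ^ m * f δ) : IsOrder n f := by
  obtain ⟨K, hK⟩ := IsBigO.bound h
  refine of_abs_le (K := K) ?_
  filter_upwards [hK, self_mem_nhdsWithin] with δ hK hδ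
  have hδ : 0 < δ := hδ
  have hp : 0 < δ ^ m := pow_pos hδ _
  rw [Real.norm_eq_abs, abs_mul, abs_of_pos hp, Real.norm_of_nonneg (pow_nonneg hδ.le _),
    pow_add] at hK
  exact le_of_mul_le_mul_left (by linarith) hp

theorem tendsto_zero (hf : IsOrder 1 f) : Tendsto f (𝓝[>] 0) (𝓝 0) := by
  refine IsBigO.trans_tendsto hf ?_
  have h : Tendsto (fun δ : ℝ => δ ^ 1) (𝓝 0) (𝓝 0) := by
    simpa using (continuous_pow 1).tendsto (0 : ℝ)
  exact h.mono_left nhdsWithin_le_nhds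

theorem tendsto {c : ℝ} (hf : IsOrder 1 fun δ => f δ - c) : Tendsto f (𝓝[>] 0) (𝓝 c) := by
  simpa using hf.tendsto_zero.add_const c

theorem bounded {c : ℝ} (hf : IsOrder 1 fun δ => f δ - c) : IsOrder 0 f :=
  ((hf.mono (Nat.zero_le 1)).add (const c)).congr_pos fun δ _ => by ring

/-- A product of factors with limits. -/
theorem mul_sub {c d : ℝ} (hf : IsOrder 1 fun δ => f δ - c) (hg : IsOrder 1 fun δ => g δ - d) :
    IsOrder 1 fun δ => f δ * g δ - c * d :=
  ((hf.mul hg.bounded).add (hg.const_mul c)).congr_pos fun δ _ => by ring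

theorem sub_sub' {c d : ℝ} (hf : IsOrder 1 fun δ => f δ - c) (hg : IsOrder 1 fun δ => g δ - d) :
    IsOrder 1 fun δ => (f δ - g δ) - (c - d) :=
  (hf.sub hg).congr_pos fun δ _ => by ring

theorem inv_of_le {c : ℝ} (hc : 0 < c) (h : ∀ᶠ δ in 𝓝[>] (0 : ℝ), c ≤ f δ) :
    IsOrder 0 fun δ => (f δ)⁻¹ := by
  refine of_abs_le (K := c⁻¹) ?_
  filter_upwards [h] with δ h
  rw [pow_zero, mul_one, abs_of_pos (inv_pos.2 (hc.trans_le h))]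
  exact inv_anti₀ hc h

theorem half_le {c : ℝ} (hc : 0 < c) (hf : IsOrder 1 fun δ => f δ - c) :
    ∀ᶠ δ in 𝓝[>] (0 : ℝ), c / 2 ≤ f δ :=
  hf.tendsto.eventually_const_le (half_lt_self hc)

/-- The means of dividing an estimate: the divisor only has to stay away from 0 and need not have a
known limit. -/
theorem of_mul_left {c : ℝ} (hc : 0 < c) (hg : ∀ᶠ δ in 𝓝[>] (0 : ℝ), c ≤ g δ)
    (h : IsOrder n fun δ => g δ * f δ) : IsOrder n f := by
  have := ((inv_of_le hc hg).mul h).congr (g := f) (by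
    filter_upwards [hg] with δ hg
    rw [inv_mul_cancel_left₀ (hc.trans_le hg).ne'])
  simpa using this

/-- The square root of a quantity close to `c ^ 2`. -/
theorem of_sq {c : ℝ} (hc : 0 < c) (hf : ∀ᶠ δ in 𝓝[>] (0 : ℝ), 0 ≤ f δ)
    (h : IsOrder n fun δ => f δ ^ 2 - c ^ 2) : IsOrder n fun δ => f δ - c := by
  refine of_mul_left (g := fun δ => f δ + c) hc ?_ (h.congr_pos fun δ _ => by ring)
  filter_upwards [hf] with δ hf
  linarith

end IsOrder

/-! ### Eigenvalue asymptotics from symmetric functions -/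

/-- Three ordered positive quantities of orders `δ ^ 4`, `δ ^ 2`, `1` are determined to leading
order by their elementary symmetric functions. -/
theorem isOrder_of_esymm {l₁ l₂ l₃ : ℝ → ℝ} {r m d : ℝ} (hr : 0 < r) (hm : 0 < m)
    (hl : ∀ᶠ δ in 𝓝[>] (0 : ℝ), 0 < l₁ δ ∧ l₁ δ ≤ l₂ δ ∧ l₂ δ ≤ l₃ δ)
    (h1 : IsOrder 1 fun δ => l₁ δ + l₂ δ + l₃ δ - 3 * r)
    (h2 : IsOrder 3 fun δ => l₁ δ * l₂ δ + l₁ δ * l₃ δ + l₂ δ * l₃ δ - 3 / 2 * m * δ ^ 2)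
    (h3 : IsOrder 7 fun δ => l₁ δ * l₂ δ * l₃ δ - d / 64 * δ ^ 6) :
    IsOrder 5 (fun δ => l₁ δ - d / (96 * m) * δ ^ 4) ∧
    IsOrder 3 (fun δ => l₂ δ - m / (2 * r) * δ ^ 2) ∧
    IsOrder 1 (fun δ => l₃ δ - 3 * r) := by
  -- The largest of the three is at least a third of their sum, and the sum is eventually at least
  -- 3r/2.
  have hl3 : ∀ᶠ δ in 𝓝[>] (0 : ℝ), r / 2 ≤ l₃ δ := by
    filter_upwards [hl, h1.half_le (by positivity)] with δ h h'
    linarith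
  have hr2 : 0 < r / 2 := by positivity
  have he2 : IsOrder 2 fun δ => l₁ δ * l₂ δ + l₁ δ * l₃ δ + l₂ δ * l₃ δ :=
    ((h2.mono (by norm_num)).add ((IsOrder.pow 2).const_mul (3 / 2 * m))).congr_pos
      fun δ _ => by ring
  have he3 : IsOrder 6 fun δ => l₁ δ * l₂ δ * l₃ δ :=
    ((h3.mono (by norm_num)).add ((IsOrder.pow 6).const_mul (d / 64))).congr_pos
      fun δ _ => by ring
  have hl2 : IsOrder 2 l₂ := by
    refine IsOrder.of_mul_left hr2 hl3 (he2.of_abs_le_abs ?_)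
    filter_upwards [hl] with δ ⟨h, h', h''⟩
    have p2 := h.trans_le h'
    have p3 := p2.trans_le h''
    rw [abs_of_pos (by positivity), abs_of_pos (by positivity)]
    nlinarith [mul_pos h p2, mul_pos h p3]
  have hl1 : IsOrder 2 l₁ := by
    refine hl2.of_abs_le_abs ?_
    filter_upwards [hl] with δ ⟨h, h', h''⟩
    rwa [abs_of_pos h, abs_of_pos (h.trans_le h')]
  have l3 : IsOrder 1 (fun δ => l₃ δ - 3 * r) :=
    ((h1.sub (hl1.mono (by norm_num))).sub (hl2.mono (by norm_num))).congr_pos fun δ _ => by ring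
  -- Each pairwise product is at most λ₂λ₃, so λ₂λ₃ ≥ e₂/3, while e₂/δ² is eventually at least 3m/4.
  have hlow : ∀ᶠ δ in 𝓝[>] (0 : ℝ), m / 4 ≤ l₂ δ * l₃ δ * (δ ^ 2)⁻¹ := by
    have h2' : IsOrder 1 fun δ => (l₁ δ * l₂ δ + l₁ δ * l₃ δ + l₂ δ * l₃ δ) * (δ ^ 2)⁻¹
        - 3 / 2 * m := by
      refine IsOrder.cancel (m := 2) (h2.congr_pos fun δ hδ => ?_)
      field_simp
    filter_upwards [hl, h2'.half_le (by positivity), self_mem_nhdsWithin] with δ ⟨h, h', h''⟩ h4 hδ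
    have hδ : 0 < δ := hδ
    have hi : 0 < (δ ^ 2)⁻¹ := by positivity
    have p2 := h.trans_le h'
    have p3 := p2.trans_le h''
    have : l₁ δ * l₂ δ + l₁ δ * l₃ δ + l₂ δ * l₃ δ ≤ 3 * (l₂ δ * l₃ δ) := by
      nlinarith [mul_le_mul_of_nonneg_left h'' p2.le, mul_le_mul_of_nonneg_right h' p3.le,
        mul_le_mul_of_nonneg_right h' p2.le]
    have := mul_le_mul_of_nonneg_right this hi.le
    linarith
  have hl1' : IsOrder 4 l₁ := by
    refine IsOrder.of_mul_left (by positivity) hlow (IsOrder.cancel (m := 2) ?_)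
    exact he3.congr_pos fun δ hδ => by field_simp
  -- With λ₁ = O(δ⁴) now known, the terms λ₁(λ₂ + λ₃) of e₂ are negligible.
  have hl23 : IsOrder 3 fun δ => l₂ δ * l₃ δ - 3 / 2 * m * δ ^ 2 := by
    have := hl1'.mul ((hl2.mono (Nat.zero_le 2)).add l3.bounded)
    exact (h2.sub (this.mono (by norm_num))).congr_pos fun δ _ => by ring
  refine ⟨?_, ?_, l3⟩
  · refine IsOrder.of_mul_left (by positivity) hlow (IsOrder.cancel (m := 2) ?_)
    have := ((IsOrder.pow 4).const_mul (d / (96 * m))).mul hl23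
    refine (h3.sub this).congr_pos fun δ hδ => ?_
    field_simp
    ring
  · refine IsOrder.of_mul_left hr2 hl3 ?_
    have := ((IsOrder.pow 2).const_mul (m / (2 * r))).mul l3
    refine (hl23.sub this).congr_pos fun δ hδ => ?_
    field_simp
    ring

/-! ### Eigenvector asymptotics -/

/-- The unit vector `v = (p, q, s)` is an eigenvector of `A M Aᵀ` for the eigenvalue `lam`, where
`M` is the symmetric matrix with lower triangle `m` and
`A = !![1, 0, 0; 1, δ / 2, 0; 1, δ, δ ^ 2 / 4]`. The vector `w` is `Aᵀ v`. -/
structure IsEigenpair (m : ℕ → ℕ → ℝ → ℝ) (lam p q s w₀ w₁ w₂ : ℝ → ℝ) : Prop where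
  norm : ∀ᶠ δ in 𝓝[>] (0 : ℝ), p δ ^ 2 + q δ ^ 2 + s δ ^ 2 = 1
  w₀_eq : ∀ δ, w₀ δ = p δ + q δ + s δ
  w₁_eq : ∀ δ, w₁ δ = δ / 2 * q δ + δ * s δ
  w₂_eq : ∀ δ, w₂ δ = δ ^ 2 / 4 * s δ
  row₀ : ∀ᶠ δ in 𝓝[>] (0 : ℝ), m 0 0 δ * w₀ δ + m 1 0 δ * w₁ δ + m 2 0 δ * w₂ δ = lam δ * p δ
  row₁ : ∀ᶠ δ in 𝓝[>] (0 : ℝ), δ / 2 * (m 1 0 δ * w₀ δ + m 1 1 δ * w₁ δ + m 2 1 δ * w₂ δ) =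
    lam δ * (q δ - p δ)
  row₂ : ∀ᶠ δ in 𝓝[>] (0 : ℝ), δ * (m 1 0 δ * w₀ δ + m 1 1 δ * w₁ δ + m 2 1 δ * w₂ δ) +
    δ ^ 2 / 4 * (m 2 0 δ * w₀ δ + m 2 1 δ * w₁ δ + m 2 2 δ * w₂ δ) = lam δ * (s δ - p δ)

variable {m : ℕ → ℕ → ℝ → ℝ} {r : ℕ → ℕ → ℝ} {lam p q s w₀ w₁ w₂ : ℝ → ℝ}

namespace IsEigenpair

theorem bounded₀ (h : IsEigenpair m lam p q s w₀ w₁ w₂) : IsOrder 0 p := by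
  refine IsOrder.of_abs_le (K := 1) ?_
  filter_upwards [h.norm] with δ h
  rw [pow_zero, one_mul]
  exact (sq_le_one_iff_abs_le_one _).1 (by nlinarith [sq_nonneg (q δ), sq_nonneg (s δ)])

theorem bounded₁ (h : IsEigenpair m lam p q s w₀ w₁ w₂) : IsOrder 0 q := by
  refine IsOrder.of_abs_le (K := 1) ?_
  filter_upwards [h.norm] with δ h
  rw [pow_zero, one_mul]
  exact (sq_le_one_iff_abs_le_one _).1 (by nlinarith [sq_nonneg (p δ), sq_nonneg (s δ)])

theorem bounded₂ (h : IsEigenpair m lam p q s w₀ w₁ w₂) : IsOrder 0 s := by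
  refine IsOrder.of_abs_le (K := 1) ?_
  filter_upwards [h.norm] with δ h
  rw [pow_zero, one_mul]
  exact (sq_le_one_iff_abs_le_one _).1 (by nlinarith [sq_nonneg (p δ), sq_nonneg (q δ)])

theorem isOrder_w₀ (h : IsEigenpair m lam p q s w₀ w₁ w₂) : IsOrder 0 w₀ :=
  ((h.bounded₀.add h.bounded₁).add h.bounded₂).congr_pos fun δ _ => by rw [h.w₀_eq]

theorem isOrder_w₁ (h : IsEigenpair m lam p q s w₀ w₁ w₂) : IsOrder 1 w₁ :=
  (IsOrder.id.mul ((h.bounded₁.const_mul (1 / 2)).add h.bounded₂)).congr_pos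
    fun δ _ => by rw [h.w₁_eq]; ring

theorem isOrder_w₂ (h : IsEigenpair m lam p q s w₀ w₁ w₂) : IsOrder 2 w₂ :=
  ((IsOrder.pow 2).mul (h.bounded₂.const_mul (1 / 4))).congr_pos
    fun δ _ => by rw [h.w₂_eq]; ring

/-- The eigenvector for the smallest eigenvalue. -/
theorem smallest (h : IsEigenpair m lam p q s w₀ w₁ w₂)
    (hm : ∀ k ≤ 2, ∀ l ≤ 2, IsOrder 1 fun δ => m k l δ - r k l)
    {m33 m32 m31 : ℝ} (h33 : m33 = r 0 0 * r 1 1 - r 1 0 * r 1 0)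
    (h32 : m32 = r 0 0 * r 2 1 - r 1 0 * r 2 0) (h31 : m31 = r 1 0 * r 2 1 - r 1 1 * r 2 0)
    (hpos : 0 < m33) (hlam : IsOrder 4 lam) (hs : ∀ δ, 0 ≤ s δ) :
    (IsOrder 1 (fun δ => p δ - 1 / √6) ∧ IsOrder 1 (fun δ => q δ - -2 / √6) ∧
      IsOrder 1 (fun δ => s δ - 1 / √6)) ∧
    IsOrder 3 (fun δ => w₀ δ - m31 / (4 * √6 * m33) * δ ^ 2) ∧
    IsOrder 3 (fun δ => w₁ δ - -m32 / (4 * √6 * m33) * δ ^ 2) ∧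
    IsOrder 3 (fun δ => w₂ δ - 1 / (4 * √6) * δ ^ 2) := by
  have m00 := hm 0 (by norm_num) 0 (by norm_num)
  have m10 := hm 1 (by norm_num) 0 (by norm_num)
  have m11 := hm 1 (by norm_num) 1 (by norm_num)
  have m20 := hm 2 (by norm_num) 0 (by norm_num)
  have m21 := hm 2 (by norm_num) 1 (by norm_num)
  have n0 : IsOrder 4 fun δ => m 0 0 δ * w₀ δ + m 1 0 δ * w₁ δ + m 2 0 δ * w₂ δ :=
    (hlam.mul h.bounded₀).congr (by filter_upwards [h.row₀] with δ h using h.symm)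
  -- The differenced row carries a factor δ/2; dividing by it costs one order.
  have n1 : IsOrder 3 fun δ => m 1 0 δ * w₀ δ + m 1 1 δ * w₁ δ + m 2 1 δ * w₂ δ := by
    refine IsOrder.cancel (m := 1) ?_
    refine ((hlam.mul (h.bounded₁.sub h.bounded₀)).const_mul 2).congr ?_
    filter_upwards [h.row₁] with δ h
    rw [← h]
    ring
  have E33 := (m00.mul_sub m11).sub_sub' (m10.mul_sub m10)
  have E32 := (m00.mul_sub m21).sub_sub' (m10.mul_sub m20)
  have E31 := (m10.mul_sub m21).sub_sub' (m11.mul_sub m20)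
  rw [← h33] at E33
  rw [← h32] at E32
  rw [← h31] at E31
  have hΔ := E33.half_le hpos
  have hw2 := h.isOrder_w₂
  -- Cramer's rule for the first two components of M w, nearly zero, as a system in w₀, w₁ with w₂
  -- as parameter; its determinant tends to m33 > 0.
  have a0 : IsOrder 3 fun δ => w₀ δ - m31 / m33 * w₂ δ := by
    refine IsOrder.of_mul_left (half_pos hpos) hΔ ?_
    refine (((m11.bounded.mul (n0.mono (by norm_num))).sub (m10.bounded.mul n1)).add
      ((hw2.mul E31).sub ((hw2.mul E33).const_mul (m31 / m33)))).congr_pos fun δ _ => ?_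
    field_simp
    ring
  have a1 : IsOrder 3 fun δ => w₁ δ - -m32 / m33 * w₂ δ := by
    refine IsOrder.of_mul_left (half_pos hpos) hΔ ?_
    refine (((m00.bounded.mul n1).sub (m10.bounded.mul (n0.mono (by norm_num)))).sub
      ((hw2.mul E32).sub ((hw2.mul E33).const_mul (m32 / m33)))).congr_pos fun δ _ => ?_
    field_simp
    ring
  have b0 : IsOrder 2 w₀ :=
    ((a0.mono (by norm_num)).add (hw2.const_mul (m31 / m33))).congr_pos fun δ _ => by ring
  have b1 : IsOrder 2 w₁ :=
    ((a1.mono (by norm_num)).add (hw2.const_mul (-m32 / m33))).congr_pos fun δ _ => by ring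
  -- Since w₁ = (δ/2)(q + 2s), the bound w₁ = O(δ²) forces q ≈ -2s; then w₀ = p + q + s ≈ 0 forces p
  -- ≈ s.
  have c1 : IsOrder 1 fun δ => q δ + 2 * s δ := by
    refine IsOrder.cancel (m := 1) ((b1.const_mul 2).congr_pos fun δ _ => ?_)
    rw [h.w₁_eq]
    ring
  have c0 : IsOrder 1 fun δ => p δ - s δ :=
    ((b0.mono (by norm_num)).sub c1).congr_pos fun δ _ => by rw [h.w₀_eq]; ring
  have h6 : (1 / √6) ^ 2 = 1 / 6 := by rw [div_pow, Real.sq_sqrt (by norm_num)]; norm_num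
  have s1 : IsOrder 1 (fun δ => s δ - 1 / √6) := by
    refine IsOrder.of_sq (by positivity) (Eventually.of_forall hs) ?_
    -- The unit norm gives 1 - 6s² = (p - s)(p + s) + (q + 2s)(q - 2s) = O(δ).
    have t0 := c0.mul (h.bounded₀.add h.bounded₂)
    have t1 := c1.mul (h.bounded₁.sub (h.bounded₂.const_mul 2))
    refine ((t0.add t1).const_mul (-1 / 6)).congr ?_
    filter_upwards [h.norm] with δ h
    rw [h6]
    linear_combination (-1 / 6) * h
  have w2' : IsOrder 3 (fun δ => w₂ δ - 1 / (4 * √6) * δ ^ 2) :=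
    (((IsOrder.pow 2).const_mul (1 / 4)).mul s1).congr_pos fun δ _ => by
      rw [h.w₂_eq]
      field_simp
  refine ⟨⟨?_, ?_, s1⟩, ?_, ?_, w2'⟩
  · exact (c0.add s1).congr_pos fun δ _ => by ring
  · exact (c1.sub (s1.const_mul 2)).congr_pos fun δ _ => by ring
  · exact (a0.add (w2'.const_mul (m31 / m33))).congr_pos fun δ _ => by field_simp; ring
  · exact (a1.add (w2'.const_mul (-m32 / m33))).congr_pos fun δ _ => by field_simp; ring

/-- The eigenvector for the middle eigenvalue; `t` is the eigenvector for the smallest one. -/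
theorem middle (h : IsEigenpair m lam p q s w₀ w₁ w₂)
    (hm : ∀ k ≤ 2, ∀ l ≤ 2, IsOrder 1 fun δ => m k l δ - r k l)
    (hpos : 0 < r 0 0) (hlam : IsOrder 2 lam) (hp : ∀ δ, 0 ≤ p δ) {t₀ t₁ t₂ : ℝ → ℝ}
    (ht : IsOrder 1 (fun δ => t₀ δ - 1 / √6) ∧ IsOrder 1 (fun δ => t₁ δ - -2 / √6) ∧
      IsOrder 1 (fun δ => t₂ δ - 1 / √6))
    (horth : ∀ᶠ δ in 𝓝[>] (0 : ℝ), t₀ δ * p δ + t₁ δ * q δ + t₂ δ * s δ = 0) :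
    (IsOrder 1 (fun δ => p δ - 1 / √2) ∧ IsOrder 1 q ∧ IsOrder 1 (fun δ => s δ - -1 / √2)) ∧
    IsOrder 2 (fun δ => w₀ δ - r 1 0 / (√2 * r 0 0) * δ) ∧
    IsOrder 2 (fun δ => w₁ δ - -1 / √2 * δ) ∧ IsOrder 2 w₂ := by
  have m00 := hm 0 (by norm_num) 0 (by norm_num)
  have m10 := hm 1 (by norm_num) 0 (by norm_num)
  have m20 := hm 2 (by norm_num) 0 (by norm_num)
  have hw1 := h.isOrder_w₁
  have hw2 := h.isOrder_w₂
  have n0 : IsOrder 2 fun δ => m 0 0 δ * w₀ δ + m 1 0 δ * w₁ δ + m 2 0 δ * w₂ δ :=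
    (hlam.mul h.bounded₀).congr (by filter_upwards [h.row₀] with δ h using h.symm)
  have n0' : IsOrder 2 fun δ => m 0 0 δ * w₀ δ + m 1 0 δ * w₁ δ :=
    (n0.sub (m20.bounded.mul hw2)).congr_pos fun δ _ => by ring
  have b0 : IsOrder 1 w₀ := by
    refine IsOrder.of_mul_left (half_pos hpos) (m00.half_le hpos) ?_
    exact ((n0'.mono (by norm_num)).sub (m10.bounded.mul hw1)).congr_pos fun δ _ => by ring
  -- Orthogonality to t, whose limit is (1, -2, 1)/√6. Together with w₀ = p + q + s = O(δ) it leaves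
  -- only the direction (1, 0, -1).
  have o : IsOrder 1 fun δ => p δ - 2 * q δ + s δ := by
    have := ((ht.1.mul h.bounded₀).add (ht.2.1.mul h.bounded₁)).add (ht.2.2.mul h.bounded₂)
    refine (this.const_mul (-√6)).congr ?_
    filter_upwards [horth] with δ h
    have h6 : √6 * (1 / √6) = 1 := mul_one_div_cancel (by positivity)
    linear_combination (-√6) * h + (p δ - 2 * q δ + s δ) * h6
  have q1 : IsOrder 1 q := ((b0.sub o).const_mul (1 / 3)).congr_pos fun δ _ => by
    rw [h.w₀_eq]
    ring
  have c : IsOrder 1 fun δ => p δ + s δ := (b0.sub q1).congr_pos fun δ _ => by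
    rw [h.w₀_eq]
    ring
  have h2 : (1 / √2) ^ 2 = 1 / 2 := by rw [div_pow, Real.sq_sqrt (by norm_num)]; norm_num
  have p1 : IsOrder 1 (fun δ => p δ - 1 / √2) := by
    refine IsOrder.of_sq (by positivity) (Eventually.of_forall hp) ?_
    refine (((c.mul (h.bounded₀.sub h.bounded₂)).sub (q1.mul h.bounded₁)).const_mul
      (1 / 2)).congr ?_
    filter_upwards [h.norm] with δ h
    rw [h2]
    linear_combination (-1 / 2) * h
  have s1 : IsOrder 1 (fun δ => s δ - -1 / √2) := (c.sub p1).congr_pos fun δ _ => by ring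
  have w1' : IsOrder 2 (fun δ => w₁ δ - -1 / √2 * δ) :=
    (IsOrder.id.mul ((q1.const_mul (1 / 2)).add s1)).congr_pos fun δ _ => by
      rw [h.w₁_eq]
      ring
  refine ⟨⟨p1, q1, s1⟩, ?_, w1', hw2⟩
  -- The first component of M w is O(δ²), and w₁ ≈ -δ/√2, so r₀₀ w₀ ≈ r₁₀ δ/√2.
  refine IsOrder.of_mul_left (half_pos hpos) (m00.half_le hpos) ?_
  have e1 := (m10.mul hw1)
  have e2 := w1'.const_mul (r 1 0)
  have e3 := (m00.mul IsOrder.id).const_mul (r 1 0 / (√2 * r 0 0))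
  refine (((n0'.sub e1).sub e2).sub e3).congr_pos fun δ _ => ?_
  field_simp
  ring

/-- The eigenvector for the largest eigenvalue. -/
theorem largest (h : IsEigenpair m lam p q s w₀ w₁ w₂)
    (hm : ∀ k ≤ 2, ∀ l ≤ 2, IsOrder 1 fun δ => m k l δ - r k l)
    (hpos : 0 < r 0 0) (hlam : IsOrder 1 fun δ => lam δ - 3 * r 0 0) (hp : ∀ δ, 0 ≤ p δ) :
    (IsOrder 1 (fun δ => p δ - 1 / √3) ∧ IsOrder 1 (fun δ => q δ - 1 / √3) ∧
      IsOrder 1 (fun δ => s δ - 1 / √3)) ∧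
    IsOrder 1 (fun δ => w₀ δ - √3) ∧ IsOrder 1 w₁ ∧ IsOrder 1 w₂ := by
  have hw0 := h.isOrder_w₀
  have hw1 := h.isOrder_w₁
  have hw2 := h.isOrder_w₂
  have m10 := (hm 1 (by norm_num) 0 (by norm_num)).bounded
  have m20 := (hm 2 (by norm_num) 0 (by norm_num)).bounded
  have m11 := (hm 1 (by norm_num) 1 (by norm_num)).bounded
  have m21 := (hm 2 (by norm_num) 1 (by norm_num)).bounded
  have m22 := (hm 2 (by norm_num) 2 (by norm_num)).bounded
  have hw1' := hw1.mono (Nat.zero_le 1)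
  have hw2' := hw2.mono (Nat.zero_le 2)
  have n1 := ((m10.mul hw0).add (m11.mul hw1')).add (m21.mul hw2')
  have n2 := ((m20.mul hw0).add (m21.mul hw1')).add (m22.mul hw2')
  have hlow := hlam.half_le (by positivity)
  have hr : 0 < 3 * r 0 0 / 2 := by positivity
  -- The differenced rows have left sides O(δ), and here λ is bounded below, so the coordinates of v
  -- agree up to O(δ).
  have c1 : IsOrder 1 fun δ => q δ - p δ := by
    refine IsOrder.of_mul_left hr hlow ((IsOrder.id.mul (n1.const_mul (1 / 2))).congr ?_)
    filter_upwards [h.row₁] with δ h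
    rw [← h]
    ring
  have c2 : IsOrder 1 fun δ => s δ - p δ := by
    refine IsOrder.of_mul_left hr hlow (((IsOrder.id.mul n1).add
      (((IsOrder.pow 2).mul (n2.const_mul (1 / 4))).mono (by norm_num))).congr ?_)
    filter_upwards [h.row₂] with δ h
    rw [← h]
    ring
  have h3 : (1 / √3) ^ 2 = 1 / 3 := by rw [div_pow, Real.sq_sqrt (by norm_num)]; norm_num
  have p1 : IsOrder 1 (fun δ => p δ - 1 / √3) := by
    refine IsOrder.of_sq (by positivity) (Eventually.of_forall hp) ?_
    refine (((c1.mul (h.bounded₁.add h.bounded₀)).add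
      (c2.mul (h.bounded₂.add h.bounded₀))).const_mul (-1 / 3)).congr ?_
    filter_upwards [h.norm] with δ h
    rw [h3]
    linear_combination (-1 / 3) * h
  have q1 : IsOrder 1 (fun δ => q δ - 1 / √3) := (c1.add p1).congr_pos fun δ _ => by ring
  have s1 : IsOrder 1 (fun δ => s δ - 1 / √3) := (c2.add p1).congr_pos fun δ _ => by ring
  refine ⟨⟨p1, q1, s1⟩, ?_, hw1, hw2.mono (by norm_num)⟩
  refine ((p1.add q1).add s1).congr_pos fun δ _ => ?_
  have : √3 = 3 * (1 / √3) := by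
    field_simp
    exact Real.sq_sqrt (by norm_num)
  rw [h.w₀_eq]
  linear_combination this

end IsEigenpair

/-! ### Divided differences and derivatives -/

/-- Divided difference approximations, with step `δ / 2`, of the derivatives of order
`k ≤ 2` at `x`. -/
def divDiff (k : ℕ) (f : ℝ → ℝ) (x δ : ℝ) : ℝ :=
  match k with
  | 0 => f x
  | 1 => (f (x + δ / 2) - f x) / (δ / 2)
  | _ => (f (x + δ) - 2 * f (x + δ / 2) + f x) / (δ / 2) ^ 2

/-- Mixed divided differences of a function of two variables. -/
def divDiff₂ (k l : ℕ) (R : ℝ → ℝ → ℝ) (x δ : ℝ) : ℝ :=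
  divDiff k (fun s => divDiff l (R s) x δ) x δ

theorem divDiff_congr {f g : ℝ → ℝ} {x δ : ℝ} (hδ : 0 ≤ δ)
    (h : ∀ t ∈ Icc x (x + δ), f t = g t) (k : ℕ) : divDiff k f x δ = divDiff k g x δ := by
  have h0 := h x ⟨le_rfl, by linarith⟩
  have h1 := h (x + δ / 2) ⟨by linarith, by linarith⟩
  have h2 := h (x + δ) ⟨by linarith, le_rfl⟩
  unfold divDiff
  split <;> simp only [h0, h1, h2]

theorem hasDerivWithinAt_divDiff {H : ℝ → ℝ → ℝ} {H' : ℝ → ℝ} {S : Set ℝ} {x δ s : ℝ} (hδ : 0 ≤ δ)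
    (h : ∀ t ∈ Icc x (x + δ), HasDerivWithinAt (fun s => H s t) (H' t) S s) (k : ℕ) :
    HasDerivWithinAt (fun s => divDiff k (H s) x δ) (divDiff k H' x δ) S s := by
  have h0 := h x ⟨le_rfl, by linarith⟩
  have h1 := h (x + δ / 2) ⟨by linarith, by linarith⟩
  have h2 := h (x + δ) ⟨by linarith, le_rfl⟩
  unfold divDiff
  split
  · exact h0
  · exact (h1.sub h0).div_const _
  · exact ((h2.sub (h1.const_mul 2)).add h0).div_const _

theorem exists_sub_eq_mul_of_hasDerivWithinAt {f f' : ℝ → ℝ} {c d : ℝ} (hcd : c < d)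
    (h : ∀ t ∈ Icc c d, HasDerivWithinAt f (f' t) (Icc c d) t) :
    ∃ ξ ∈ Icc c d, f d - f c = f' ξ * (d - c) := by
  obtain ⟨ξ, hξ, h'⟩ := exists_hasDerivAt_eq_slope f f' hcd
    (fun t ht => (h t ht).continuousWithinAt)
    fun t ht => (h t (Ioo_subset_Icc_self ht)).hasDerivAt (Icc_mem_nhds ht.1 ht.2)
  refine ⟨ξ, Ioo_subset_Icc_self hξ, ?_⟩
  rw [h', div_mul_cancel₀ _ (sub_pos.2 hcd).ne']

/-- A divided difference is a derivative at an intermediate point. -/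
theorem exists_divDiff_eq {F : ℕ → ℝ → ℝ} {x δ : ℝ} (hδ : 0 < δ)
    (hF : ∀ j < 2, ∀ t ∈ Icc x (x + δ), HasDerivWithinAt (F j) (F (j + 1) t) (Icc x (x + δ)) t)
    {k : ℕ} (hk : k ≤ 2) : ∃ ξ ∈ Icc x (x + δ), divDiff k (F 0) x δ = F k ξ := by
  have hsub {c d : ℝ} (hc : x ≤ c) (hd : d ≤ x + δ) : Icc c d ⊆ Icc x (x + δ) :=
    Icc_subset_Icc hc hd
  have hh : 0 < δ / 2 := half_pos hδ
  interval_cases k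
  · exact ⟨x, ⟨le_rfl, by linarith⟩, rfl⟩
  · have hs := hsub (le_refl x) (show x + δ / 2 ≤ x + δ by linarith)
    obtain ⟨ξ, hξ, h⟩ := exists_sub_eq_mul_of_hasDerivWithinAt (f := F 0) (f' := F 1)
      (lt_add_of_pos_right x hh) fun t ht => (hF 0 (by norm_num) t (hs ht)).mono hs
    refine ⟨ξ, hs hξ, ?_⟩
    rw [divDiff, h]
    field_simp
    ring
  · have hs := hsub (le_refl x) (show x + δ / 2 ≤ x + δ by linarith)
    -- The second difference is the increment over [x, x + δ/2] of t ↦ F₀(t + δ/2) - F₀(t). The mean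
    -- value theorem is applied to this function and then to F₁ on [ξ, ξ + δ/2].
    obtain ⟨ξ, hξ, h⟩ := exists_sub_eq_mul_of_hasDerivWithinAt
      (f := fun t => F 0 (t + δ / 2) - F 0 t) (f' := fun t => F 1 (t + δ / 2) - F 1 t)
      (lt_add_of_pos_right x hh) fun t ht => by
        refine HasDerivWithinAt.sub ?_ ((hF 0 (by norm_num) t (hs ht)).mono hs)
        have h1 := hF 0 (by norm_num) (t + δ / 2) ⟨by linarith [ht.1], by linarith [ht.2]⟩
        have h2 : HasDerivWithinAt (fun t => t + δ / 2) 1 (Icc x (x + δ / 2)) t :=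
          (hasDerivWithinAt_id t _).add_const _
        have h3 : MapsTo (fun t => t + δ / 2) (Icc x (x + δ / 2)) (Icc x (x + δ)) :=
          fun y hy => ⟨by linarith [hy.1], by linarith [hy.2]⟩
        simpa using! h1.comp t h2 h3
    have hs' := hsub hξ.1 (show ξ + δ / 2 ≤ x + δ by linarith [hξ.2])
    obtain ⟨η, hη, h'⟩ := exists_sub_eq_mul_of_hasDerivWithinAt (f := F 1) (f' := F 2)
      (lt_add_of_pos_right ξ hh) fun t ht => (hF 1 (by norm_num) t (hs' ht)).mono hs'
    refine ⟨η, hs' hη, ?_⟩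
    rw [h'] at h
    have e : x + δ / 2 + δ / 2 = x + δ := by ring
    simp only [e] at h
    have : F 0 (x + δ) - 2 * F 0 (x + δ / 2) + F 0 x = F 2 η * (δ / 2) ^ 2 := by
      linear_combination h
    rw [divDiff, this, mul_div_cancel_right₀ _ (by positivity)]
    all_goals simp

/-- One variable at a time: differentiation in s commutes with the finite difference in t, so the
intermediate point ξ comes first, and η is then found for the function t ↦ D k 0 ξ t. -/
theorem exists_divDiff₂_eq {D : ℕ → ℕ → ℝ → ℝ → ℝ} {x δ : ℝ} (hδ : 0 < δ)
    (h₁ : ∀ k < 2, ∀ s ∈ Icc x (x + δ), ∀ t ∈ Icc x (x + δ),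
      HasDerivWithinAt (fun s => D k 0 s t) (D (k + 1) 0 s t) (Icc x (x + δ)) s)
    (h₂ : ∀ k ≤ 2, ∀ l < 2, ∀ s ∈ Icc x (x + δ), ∀ t ∈ Icc x (x + δ),
      HasDerivWithinAt (fun t => D k l s t) (D k (l + 1) s t) (Icc x (x + δ)) t)
    {k l : ℕ} (hk : k ≤ 2) (hl : l ≤ 2) :
    ∃ ξ ∈ Icc x (x + δ), ∃ η ∈ Icc x (x + δ), divDiff₂ k l (D 0 0) x δ = D k l ξ η := by
  obtain ⟨ξ, hξ, h⟩ := exists_divDiff_eq (F := fun j s => divDiff l (D j 0 s) x δ) hδ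
    (fun j hj s hs => hasDerivWithinAt_divDiff hδ.le (fun t ht => h₁ j hj s hs t ht) l) hk
  obtain ⟨η, hη, h'⟩ := exists_divDiff_eq (F := fun j t => D k j ξ t) hδ
    (fun j hj t ht => h₂ k hk j hj ξ hξ t ht) hl
  exact ⟨ξ, hξ, η, hη, h.trans h'⟩

theorem abs_sub_le_of_hasDerivWithinAt {f f' : ℝ → ℝ} {x δ K ξ : ℝ}
    (h : ∀ t ∈ Icc x (x + δ), HasDerivWithinAt f (f' t) (Icc x (x + δ)) t)
    (hK : ∀ t ∈ Icc x (x + δ), |f' t| ≤ K) (hξ : ξ ∈ Icc x (x + δ)) :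
    |f ξ - f x| ≤ K * δ := by
  have hx : x ∈ Icc x (x + δ) := ⟨le_rfl, hξ.1.trans hξ.2⟩
  refine ((convex_Icc x (x + δ)).norm_image_sub_le_of_norm_hasDerivWithin_le h hK hx hξ).trans ?_
  refine mul_le_mul_of_nonneg_left ?_ ((abs_nonneg _).trans (hK x hx))
  rw [Real.norm_of_nonneg (sub_nonneg.2 hξ.1)]
  linarith [hξ.2]

theorem iteratedDerivWithin_eventuallyEq {F : ℕ → ℝ → ℝ} {s : Set ℝ} (hs : UniqueDiffOn ℝ s)
    {x : ℝ} {n : ℕ}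
    (h : ∀ j < n, ∀ᶠ t in 𝓝[s] x, HasDerivWithinAt (F j) (F (j + 1) t) s t) {j : ℕ} (hj : j ≤ n) :
    ∀ᶠ t in 𝓝[s] x, iteratedDerivWithin j (F 0) s t = F j t := by
  induction j with
  | zero => simp
  | succ j ih =>
    filter_upwards [eventually_eventually_nhdsWithin.2 (ih (by omega)), h j (by omega),
      self_mem_nhdsWithin] with t ht h hts
    rw [iteratedDerivWithin_succ, EventuallyEq.derivWithin_eq ht (ht.self_of_nhdsWithin hts),
      h.derivWithin (hs t hts)]

theorem iteratedDerivWithin_eq_of_chain {f : ℝ → ℝ} {F : ℕ → ℝ → ℝ} {s : Set ℝ}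
    (hs : UniqueDiffOn ℝ s) {x : ℝ} (hx : x ∈ s) {n : ℕ} (hf : ∀ᶠ t in 𝓝[s] x, f t = F 0 t)
    (h : ∀ j < n, ∀ᶠ t in 𝓝[s] x, HasDerivWithinAt (F j) (F (j + 1) t) s t) :
    iteratedDerivWithin n f s x = F n x := by
  rw [EventuallyEq.iteratedDerivWithin_eq hf (hf.self_of_nhdsWithin hx)]
  exact (iteratedDerivWithin_eventuallyEq hs h le_rfl).self_of_nhdsWithin hx

/-- The divided differences of a `C ^ 3` function approximate its derivatives. -/
theorem isOrder_divDiff_sub {a b x : ℝ} (hx : x ∈ Ico a b) {μ : ℝ → ℝ}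
    (hμ : ContDiffOn ℝ 3 μ (Icc a b)) {k : ℕ} (hk : k ≤ 2) :
    IsOrder 1 fun δ => divDiff k μ x δ - iteratedDerivWithin k μ (Icc a b) x := by
  have hu : UniqueDiffOn ℝ (Icc a b) := uniqueDiffOn_Icc (hx.1.trans_lt hx.2)
  -- As k + 1 ≤ 3, this derivative is continuous on a compact interval; its bound is a Lipschitz
  -- constant for the derivative of order k.
  obtain ⟨K, hK⟩ := isCompact_Icc.exists_bound_of_continuousOn
    (hμ.continuousOn_iteratedDerivWithin (m := k + 1) (by exact_mod_cast (by omega)) hu)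
  have hd : ∀ j < 3, ∀ t ∈ Icc a b, HasDerivWithinAt (iteratedDerivWithin j μ (Icc a b))
      (iteratedDerivWithin (j + 1) μ (Icc a b) t) (Icc a b) t := fun j hj t ht => by
    rw [iteratedDerivWithin_succ]
    exact (hμ.differentiableOn_iteratedDerivWithin (by exact_mod_cast hj) hu t
      ht).hasDerivWithinAt
  refine IsOrder.of_abs_le (K := K) ?_
  filter_upwards [Ioo_mem_nhdsGT (sub_pos.2 hx.2)] with δ hδ
  have hs : Icc x (x + δ) ⊆ Icc a b := Icc_subset_Icc hx.1 (by linarith [hδ.2])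
  obtain ⟨ξ, hξ, h⟩ := exists_divDiff_eq (F := fun j => iteratedDerivWithin j μ (Icc a b)) hδ.1
    (fun j hj t ht => (hd j (by omega) t (hs ht)).mono hs) hk
  rw [iteratedDerivWithin_zero] at h
  rw [h, pow_one]
  exact abs_sub_le_of_hasDerivWithinAt (fun t ht => (hd k (by omega) t (hs ht)).mono hs)
    (fun t ht => hK t (hs ht)) hξ

/-- Iterated derivatives within [a, b] depend only on the germ at the point, so control of the
partial derivatives on U alone suffices to identify them on the diagonal. -/
theorem diagDeriv_eq {n : ℕ} {a b x ρ : ℝ} (hx : x ∈ Ico a b) (hρ : 0 < ρ) {R : ℝ → ℝ → ℝ}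
    {U : Set (ℝ × ℝ)} {D : ℕ → ℕ → ℝ → ℝ → ℝ}
    (hU : ∀ s ∈ Metric.ball x ρ, ∀ t ∈ Metric.ball x ρ, (s, t) ∈ U)
    (h₀ : ∀ x ∈ Icc a b, ∀ y ∈ Icc a b, (x, y) ∈ U → D 0 0 x y = R x y)
    (h₁ : ∀ k < n, ∀ l ≤ n, ∀ x ∈ Icc a b, ∀ y ∈ Icc a b, (x, y) ∈ U →
      HasDerivWithinAt (fun s => D k l s y) (D (k + 1) l x y) (Icc a b) x)
    (h₂ : ∀ k ≤ n, ∀ l < n, ∀ x ∈ Icc a b, ∀ y ∈ Icc a b, (x, y) ∈ U →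
      HasDerivWithinAt (fun t => D k l x t) (D k (l + 1) x y) (Icc a b) y)
    {k l : ℕ} (hk : k ≤ n) (hl : l ≤ n) : diagDeriv a b R k l x = D k l x x := by
  have hu : UniqueDiffOn ℝ (Icc a b) := uniqueDiffOn_Icc (hx.1.trans_lt hx.2)
  have hx' : x ∈ Icc a b := Ico_subset_Icc_self hx
  have hxρ : x ∈ Metric.ball x ρ := Metric.mem_ball_self hρ
  have hev : ∀ᶠ t in 𝓝[Icc a b] x, t ∈ Metric.ball x ρ ∧ t ∈ Icc a b := by
    filter_upwards [mem_nhdsWithin_of_mem_nhds (Metric.ball_mem_nhds x hρ),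
      self_mem_nhdsWithin] with t h h' using ⟨h, h'⟩
  refine iteratedDerivWithin_eq_of_chain (F := fun k s => D k l s x) hu hx' ?_ ?_
  · filter_upwards [hev] with s hs
    refine iteratedDerivWithin_eq_of_chain (F := fun l t => D 0 l s t) hu hx' ?_ ?_
    · filter_upwards [hev] with t ht
      exact (h₀ s hs.2 t ht.2 (hU s hs.1 t ht.1)).symm
    · intro j hj
      filter_upwards [hev] with t ht
      exact h₂ 0 (Nat.zero_le n) j (by omega) s hs.2 t ht.2 (hU s hs.1 t ht.1)
  · intro j hj
    filter_upwards [hev] with s hs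
    exact h₁ j (by omega) l hl s hs.2 x hx' (hU s hs.1 x hxρ)

/-- The mixed divided differences of a function smooth near the diagonal approximate its mixed
derivatives on the diagonal. -/
theorem isOrder_divDiff₂_sub {a b x : ℝ} (hx : x ∈ Ico a b) {R : ℝ → ℝ → ℝ}
    (hR : IsSmoothNearDiag 3 a b R) {k l : ℕ} (hk : k ≤ 2) (hl : l ≤ 2) :
    IsOrder 1 fun δ => divDiff₂ k l R x δ - diagDeriv a b R k l x := by
  obtain ⟨U, D, hUo, hUd, h₀, h₁, h₂, hc⟩ := hR
  obtain ⟨ρ, hρ, hρU⟩ := Metric.isOpen_iff.1 hUo (x, x) (hUd x (Ico_subset_Icc_self hx))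
  have hU : ∀ s ∈ Metric.ball x ρ, ∀ t ∈ Metric.ball x ρ, (s, t) ∈ U := fun s hs t ht =>
    hρU (by rw [← ball_prod_same]; exact ⟨hs, ht⟩)
  rw [diagDeriv_eq hx hρ hU h₀ h₁ h₂ (by omega : k ≤ 3) (by omega : l ≤ 3)]
  -- Small enough that the closed square [x, x + ε]² lies in both U and [a, b]²; compactness then
  -- bounds all partial derivatives on it.
  set ε := min (ρ / 2) (b - x)
  have hε0 : 0 < ε := lt_min (half_pos hρ) (sub_pos.2 hx.2)
  have hεab : Icc x (x + ε) ⊆ Icc a b :=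
    Icc_subset_Icc hx.1 (by linarith [min_le_right (ρ / 2) (b - x)])
  have hερ : Icc x (x + ε) ⊆ Metric.ball x ρ := fun t ht => by
    rw [Metric.mem_ball, Real.dist_eq, abs_of_nonneg (sub_nonneg.2 ht.1)]
    linarith [ht.2, min_le_left (ρ / 2) (b - x)]
  have hbd : ∀ k ≤ 3, ∀ l ≤ 3, ∃ K, ∀ s ∈ Icc x (x + ε), ∀ t ∈ Icc x (x + ε),
      |D k l s t| ≤ K := fun k hk l hl => by
    have hsq : Icc x (x + ε) ×ˢ Icc x (x + ε) ⊆ U ∩ Icc a b ×ˢ Icc a b := fun p hp =>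
      ⟨hU _ (hερ hp.1) _ (hερ hp.2), hεab hp.1, hεab hp.2⟩
    obtain ⟨K, hK⟩ := (isCompact_Icc.prod isCompact_Icc).exists_bound_of_continuousOn
      ((hc k hk l hl).mono hsq)
    exact ⟨K, fun s hs t ht => hK (s, t) ⟨hs, ht⟩⟩
  obtain ⟨K₁, hK₁⟩ := hbd (k + 1) (by omega) l (by omega)
  obtain ⟨K₂, hK₂⟩ := hbd k (by omega) (l + 1) (by omega)
  refine IsOrder.of_abs_le (K := K₁ + K₂) ?_
  filter_upwards [Ioo_mem_nhdsGT hε0] with δ hδ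
  have hs : Icc x (x + δ) ⊆ Icc x (x + ε) := Icc_subset_Icc le_rfl (by linarith [hδ.2])
  have hsab := hs.trans hεab
  have hUs : ∀ s ∈ Icc x (x + δ), ∀ t ∈ Icc x (x + δ), (s, t) ∈ U := fun s h t h' =>
    hU s (hερ (hs h)) t (hερ (hs h'))
  have hxδ : x ∈ Icc x (x + δ) := ⟨le_rfl, by linarith [hδ.1]⟩
  have hD : divDiff₂ k l R x δ = divDiff₂ k l (D 0 0) x δ :=
    divDiff_congr hδ.1.le (fun s h => divDiff_congr hδ.1.le
      (fun t h' => (h₀ s (hsab h) t (hsab h') (hUs s h t h')).symm) l) k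
  obtain ⟨ξ, hξ, η, hη, h⟩ := exists_divDiff₂_eq (D := D) hδ.1
    (fun k hk s h t h' => (h₁ k (by omega) 0 (by omega) s (hsab h) t (hsab h')
      (hUs s h t h')).mono hsab)
    (fun k hk l hl s h t h' => (h₂ k (by omega) l (by omega) s (hsab h) t (hsab h')
      (hUs s h t h')).mono hsab) hk hl
  rw [hD, h, pow_one]
  have e₁ : |D k l ξ η - D k l x η| ≤ K₁ * δ :=
    abs_sub_le_of_hasDerivWithinAt (f := fun s => D k l s η) (f' := fun s => D (k + 1) l s η)
      (fun s h => (h₁ k (by omega) l (by omega) s (hsab h) η (hsab hη) (hUs s h η hη)).mono hsab)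
      (fun s h => hK₁ s (hs h) η (hs hη)) hξ
  have e₂ : |D k l x η - D k l x x| ≤ K₂ * δ :=
    abs_sub_le_of_hasDerivWithinAt (f := fun t => D k l x t) (f' := fun t => D k (l + 1) x t)
      (fun t h => (h₂ k (by omega) l (by omega) x (hsab hxδ) t (hsab h) (hUs x hxδ t h)).mono hsab)
      (fun t h => hK₂ x (hs hxδ) t (hs h)) hη
  calc |D k l ξ η - D k l x x| ≤ |D k l ξ η - D k l x η| + |D k l x η - D k l x x| :=
        abs_sub_le _ _ _
    _ ≤ (K₁ + K₂) * δ := by linarith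

/-! ### Spectral data of the factored matrix -/

section Matrix

/-- An increasingly ordered orthonormal eigenbasis, with prescribed signs of one coordinate of each
eigenvector. -/
theorem exists_orthonormal_eigenvectors {A : Matrix (Fin 3) (Fin 3) ℝ} (hA : A.IsHermitian)
    (c : Fin 3 → Fin 3) :
    ∃ v : Fin 3 → EuclideanSpace ℝ (Fin 3), Orthonormal ℝ v ∧
      (∀ k, Matrix.toEuclideanLin A (v k) =
        hA.eigenvalues₀ (Fin.cast (Fintype.card_fin 3).symm (Fin.rev k)) • v k) ∧
      ∀ k, 0 ≤ v k (c k) := by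
  -- `Fin.rev` turns the decreasing order of `eigenvalues₀` into an increasing one; `equivOfCardEq`
  -- is the reindexing by which `eigenvalues` and `eigenvectorBasis` are defined.
  set σ : Fin 3 → Fin 3 := fun k =>
    Fintype.equivOfCardEq (Fintype.card_fin _) (Fin.cast (Fintype.card_fin 3).symm (Fin.rev k))
    with hσ
  have hinj : Function.Injective σ := fun i j hij => by
    simp only [hσ, EmbeddingLike.apply_eq_iff_eq] at hij
    exact Fin.rev_injective (Fin.cast_injective _ hij)
  set e : Fin 3 → EuclideanSpace ℝ (Fin 3) := fun k => hA.eigenvectorBasis (σ k)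
  have heo : Orthonormal ℝ e := hA.eigenvectorBasis.orthonormal.comp σ hinj
  have hev : ∀ k, Matrix.toEuclideanLin A (e k) =
      hA.eigenvalues₀ (Fin.cast (Fintype.card_fin 3).symm (Fin.rev k)) • e k := fun k => by
    have h := hA.mulVec_eigenvectorBasis (σ k)
    have h' : hA.eigenvalues (σ k) =
        hA.eigenvalues₀ (Fin.cast (Fintype.card_fin 3).symm (Fin.rev k)) := by
      simp [Matrix.IsHermitian.eigenvalues, hσ]
    rw [h'] at h
    ext i
    simpa [Matrix.toLpLin_apply] using congrFun h i
  set g : Fin 3 → ℝ := fun k => if 0 ≤ e k (c k) then 1 else -1 with hg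
  have hg1 : ∀ k, g k * g k = 1 := fun k => by
    simp only [hg]
    split <;> norm_num
  refine ⟨fun k => g k • e k, ?_, fun k => ?_, fun k => ?_⟩
  · rw [orthonormal_iff_ite] at heo ⊢
    intro i j
    rw [real_inner_smul_left, real_inner_smul_right, heo i j]
    split_ifs with h
    · rw [h, mul_one, hg1]
    · simp
  · rw [map_smul, hev, smul_comm]
  · simp only [hg, PiLp.smul_apply, smul_eq_mul]
    split_ifs with h
    · simpa using h
    · linarith

/-- The last identity is the characteristic polynomial at 1. It encodes e₂, since the product on its
left is 1 - e₁ + e₂ - e₃. -/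
theorem esymm_eigenvalues₀ {A : Matrix (Fin 3) (Fin 3) ℝ} (hA : A.IsHermitian) {l : Fin 3 → ℝ}
    (hl : ∀ k, l k = hA.eigenvalues₀ (Fin.cast (Fintype.card_fin 3).symm (Fin.rev k))) :
    l 0 + l 1 + l 2 = A.trace ∧ l 0 * l 1 * l 2 = A.det ∧
      (1 - l 0) * (1 - l 1) * (1 - l 2) = (1 - A).det := by
  set σ : Fin 3 ≃ Fin 3 := (Fin.revPerm.trans (finCongr (Fintype.card_fin 3).symm)).trans
    (Fintype.equivOfCardEq (Fintype.card_fin _)) with hσ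
  have h' : ∀ k, hA.eigenvalues (σ k) = l k := fun k => by
    rw [hl]
    simp [Matrix.IsHermitian.eigenvalues, hσ]
  refine ⟨?_, ?_, ?_⟩
  · rw [hA.trace_eq_sum_eigenvalues, ← Equiv.sum_comp σ]
    simp [h', Fin.sum_univ_three]
  · rw [hA.det_eq_prod_eigenvalues, ← Equiv.prod_comp σ]
    simp [h', Fin.prod_univ_three]
  · have h := Matrix.eval_charpoly A 1
    rw [map_one, hA.charpoly_eq, Polynomial.eval_prod, ← Equiv.prod_comp σ] at h
    simpa [h', Fin.prod_univ_three] using h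

/-- The matrix `A M Aᵀ`, where `M` is the symmetric matrix with lower triangle `m` and
`A = !![1, 0, 0; 1, h, 0; 1, 2 * h, h ^ 2]`. -/
def vandermondeConj (m : ℕ → ℕ → ℝ) (h : ℝ) : Matrix (Fin 3) (Fin 3) ℝ :=
  !![m 0 0, m 0 0 + h * m 1 0, m 0 0 + 2 * h * m 1 0 + h ^ 2 * m 2 0;
     m 0 0 + h * m 1 0, m 0 0 + 2 * h * m 1 0 + h ^ 2 * m 1 1,
      m 0 0 + 3 * h * m 1 0 + h ^ 2 * m 2 0 + 2 * h ^ 2 * m 1 1 + h ^ 3 * m 2 1;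
     m 0 0 + 2 * h * m 1 0 + h ^ 2 * m 2 0,
      m 0 0 + 3 * h * m 1 0 + h ^ 2 * m 2 0 + 2 * h ^ 2 * m 1 1 + h ^ 3 * m 2 1,
      m 0 0 + 4 * h * m 1 0 + 2 * h ^ 2 * m 2 0 + 4 * h ^ 2 * m 1 1 + 4 * h ^ 3 * m 2 1 +
        h ^ 4 * m 2 2]

variable {m : ℕ → ℕ → ℝ → ℝ} {r : ℕ → ℕ → ℝ}

theorem isOrder_trace_vandermondeConj
    (hm : ∀ k ≤ 2, ∀ l ≤ 2, IsOrder 1 fun δ => m k l δ - r k l) :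
    IsOrder 1 fun δ => (vandermondeConj (fun k l => m k l δ) (δ / 2)).trace - 3 * r 0 0 := by
  have m00 := hm 0 (by norm_num) 0 (by norm_num)
  have m10 := (hm 1 (by norm_num) 0 (by norm_num)).bounded
  have m20 := (hm 2 (by norm_num) 0 (by norm_num)).bounded
  have m11 := (hm 1 (by norm_num) 1 (by norm_num)).bounded
  have m21 := (hm 2 (by norm_num) 1 (by norm_num)).bounded
  have m22 := (hm 2 (by norm_num) 2 (by norm_num)).bounded
  have hδ (k : ℕ) : IsOrder 0 fun δ => δ ^ k := (IsOrder.pow k).mono (Nat.zero_le k)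
  have t : IsOrder 0 fun δ => 3 * m 1 0 δ + δ ^ 1 * (1 / 2 * m 2 0 δ + 5 / 4 * m 1 1 δ) +
      δ ^ 2 * (1 / 2 * m 2 1 δ) + δ ^ 3 * (1 / 16 * m 2 2 δ) :=
    (((m10.const_mul 3).add ((hδ 1).mul ((m20.const_mul _).add (m11.const_mul _)))).add
      ((hδ 2).mul (m21.const_mul _))).add ((hδ 3).mul (m22.const_mul _))
  refine ((m00.const_mul 3).add (IsOrder.id.mul t)).congr_pos fun δ _ => ?_
  simp only [Matrix.trace_fin_three, vandermondeConj, Matrix.of_apply, Matrix.cons_val]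
  ring

/-- With h = δ/2, det A = h³, so the determinant is exactly δ⁶/64 times det M, and det M is within
O(δ) of d. -/
theorem isOrder_det_vandermondeConj {d : ℝ}
    (hm : ∀ k ≤ 2, ∀ l ≤ 2, IsOrder 1 fun δ => m k l δ - r k l)
    (hd : d = r 0 0 * (r 1 1 * r 2 2 - r 2 1 * r 2 1) - r 1 0 * (r 1 0 * r 2 2 - r 2 1 * r 2 0) +
      r 2 0 * (r 1 0 * r 2 1 - r 1 1 * r 2 0)) :
    IsOrder 7 fun δ => (vandermondeConj (fun k l => m k l δ) (δ / 2)).det - d / 64 * δ ^ 6 := by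
  have m00 := hm 0 (by norm_num) 0 (by norm_num)
  have m10 := hm 1 (by norm_num) 0 (by norm_num)
  have m20 := hm 2 (by norm_num) 0 (by norm_num)
  have m11 := hm 1 (by norm_num) 1 (by norm_num)
  have m21 := hm 2 (by norm_num) 1 (by norm_num)
  have m22 := hm 2 (by norm_num) 2 (by norm_num)
  have t := ((m00.mul_sub ((m11.mul_sub m22).sub_sub' (m21.mul_sub m21))).sub_sub'
    (m10.mul_sub ((m10.mul_sub m22).sub_sub' (m21.mul_sub m20)))).add
    (m20.mul_sub ((m10.mul_sub m21).sub_sub' (m11.mul_sub m20)))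
  refine ((IsOrder.pow 6).mul (t.const_mul (1 / 64))).congr_pos fun δ _ => ?_
  simp only [Matrix.det_fin_three, vandermondeConj, Matrix.of_apply, Matrix.cons_val, hd]
  ring

/-- The expression det(1 - C) - 1 + tr C + det C is e₂, the sum of the principal 2 × 2 minors. By
Cauchy–Binet its δ² term comes from the first two columns of A, whose 2 × 2 minors are h, 2h, h: the
coefficient is (1 + 4 + 1) h² = (3/2) δ². -/
theorem isOrder_esymm_vandermondeConj {d : ℝ}
    (hm : ∀ k ≤ 2, ∀ l ≤ 2, IsOrder 1 fun δ => m k l δ - r k l)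
    (hd : d = r 0 0 * r 1 1 - r 1 0 * r 1 0) :
    IsOrder 3 fun δ => (1 - vandermondeConj (fun k l => m k l δ) (δ / 2)).det - 1 +
      (vandermondeConj (fun k l => m k l δ) (δ / 2)).trace +
      (vandermondeConj (fun k l => m k l δ) (δ / 2)).det - 3 / 2 * d * δ ^ 2 := by
  have m00 := hm 0 (by norm_num) 0 (by norm_num)
  have m10 := hm 1 (by norm_num) 0 (by norm_num)
  have m11 := hm 1 (by norm_num) 1 (by norm_num)
  have b00 := m00.bounded
  have b10 := m10.bounded
  have b11 := m11.bounded
  have b20 := (hm 2 (by norm_num) 0 (by norm_num)).bounded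
  have b21 := (hm 2 (by norm_num) 1 (by norm_num)).bounded
  have b22 := (hm 2 (by norm_num) 2 (by norm_num)).bounded
  have hδ (k : ℕ) : IsOrder 0 fun δ => δ ^ k := (IsOrder.pow k).mono (Nat.zero_le k)
  have n2 := ((b00.mul b21).sub (b20.mul b10)).const_mul (3 / 4)
  have n3 := ((b10.mul b21).sub (b20.mul b11)).const_mul (1 / 8)
  have n4 := ((b00.mul b22).sub (b20.mul b20)).const_mul (1 / 8)
  have n5 := ((b10.mul b22).sub (b20.mul b21)).const_mul (1 / 16)
  have n6 := ((b11.mul b22).sub (b21.mul b21)).const_mul (1 / 64)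
  have t := ((n2.add ((hδ 1).mul (n3.add n4))).add ((hδ 2).mul n5)).add ((hδ 3).mul n6)
  have u := ((m00.mul_sub m11).sub_sub' (m10.mul_sub m10)).const_mul (3 / 2)
  refine (((IsOrder.pow 2).mul u).add ((IsOrder.pow 3).mul t)).congr_pos fun δ _ => ?_
  simp only [Matrix.det_fin_three, Matrix.trace_fin_three, vandermondeConj, Matrix.of_apply,
    Matrix.cons_val, Matrix.sub_apply, Matrix.one_apply, hd]
  simp only [Fin.isValue, Fin.reduceEq, if_true, if_false]
  ring

/-- A unit eigenvector of `vandermondeConj` in terms of `IsEigenpair`. -/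
theorem isEigenpair_of_vandermondeConj {C : ℝ → Matrix (Fin 3) (Fin 3) ℝ} {lam : ℝ → ℝ}
    {v : ℝ → EuclideanSpace ℝ (Fin 3)}
    (hC : ∀ δ, 0 < δ → C δ = vandermondeConj (fun k l => m k l δ) (δ / 2))
    (hn : ∀ δ, ‖v δ‖ = 1) (hv : ∀ δ, Matrix.toEuclideanLin (C δ) (v δ) = lam δ • v δ) :
    IsEigenpair m lam (fun δ => v δ 0) (fun δ => v δ 1) (fun δ => v δ 2)
      (fun δ => v δ 0 + v δ 1 + v δ 2) (fun δ => δ / 2 * v δ 1 + δ * v δ 2)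
      (fun δ => δ ^ 2 / 4 * v δ 2) := by
  have key : ∀ δ, 0 < δ → ∀ i, ∑ j, vandermondeConj (fun k l => m k l δ) (δ / 2) i j * v δ j =
      lam δ * v δ i := fun δ hδ i => by
    have h := congrArg (fun w : EuclideanSpace ℝ (Fin 3) => w i) (hv δ)
    rw [hC δ hδ] at h
    simpa [Matrix.toLpLin_apply, Matrix.mulVec, dotProduct] using h
  simp only [Fin.sum_univ_three] at key
  refine ⟨?_, fun _ => rfl, fun _ => rfl, fun _ => rfl, ?_, ?_, ?_⟩
  · refine Eventually.of_forall fun δ => ?_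
    have h := EuclideanSpace.real_norm_sq_eq (v δ)
    rw [hn, Fin.sum_univ_three] at h
    linarith
  all_goals
    filter_upwards [self_mem_nhdsWithin] with δ hδ
    have k0 := key δ hδ 0
    have k1 := key δ hδ 1
    have k2 := key δ hδ 2
    simp only [vandermondeConj, Matrix.of_apply, Matrix.cons_val] at k0 k1 k2
  · linear_combination k0
  -- Subtracting row 0 cancels the entry 1 in the first column of A and leaves an explicit factor δ.
  · linear_combination k1 - k0
  · linear_combination k2 - k0

theorem corrMatrix_minors_pos {a b x : ℝ} {R : ℝ → ℝ → ℝ} (h : (corrMatrix a b R x).PosDef) :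
    0 < diagDeriv a b R 0 0 x ∧ 0 < minor33 a b R x := by
  have h1 := h.diag_pos (i := 0)
  have h1' : 0 < diagDeriv a b R 0 0 x := by simpa [corrMatrix] using h1
  refine ⟨h1', ?_⟩
  -- On the test vector (-R₁₀, R₀₀, 0) the quadratic form equals R₀₀ (R₀₀ R₁₁ - R₁₀²).
  have h2 := h.dotProduct_mulVec_pos
    (x := ![-diagDeriv a b R 1 0 x, diagDeriv a b R 0 0 x, 0]) (fun h0 => by
      have := congrFun h0 1
      simp at this
      exact h1'.ne' this)
  refine pos_of_mul_pos_right (a := diagDeriv a b R 0 0 x) ?_ h1'.le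
  simp only [corrMatrix, dotProduct, Matrix.mulVec, Fin.sum_univ_three, Matrix.of_apply,
    Matrix.cons_val, star_trivial] at h2
  unfold minor33
  linarith

end Matrix

/-! ### The covariance matrix of the sampled field -/

section Probability

variable {Ω : Type*} [MeasurableSpace Ω] {P : Measure Ω} {a b : ℝ} {u : ℝ → Ω → ℝ}

theorem covMatrix_T_eq {x δ : ℝ} (hδ : 0 < δ) :
    covMatrix P (T u x δ) = vandermondeConj (fun k l => divDiff₂ k l (corr P u) x δ) (δ / 2) := by
  have hs (s t : ℝ) : corr P u s t = corr P u t s := covariance_comm _ _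
  have hc (s t : ℝ) : cov[fun ω => u s ω, fun ω => u t ω; P] = corr P u s t := rfl
  have s1 := hs x (x + δ / 2)
  have s2 := hs x (x + δ)
  have s3 := hs (x + δ / 2) (x + δ)
  ext i j
  fin_cases i <;> fin_cases j <;>
    simp only [covMatrix, T, sample, vandermondeConj, divDiff₂, divDiff, Matrix.of_apply,
      Fin.zero_eta, Fin.mk_one, Fin.reduceFinMk, Matrix.cons_val, hc, s1, s2, s3] <;>
    field_simp <;> ring

theorem hasGaussianLaw_T (h : G1 P a b u) {x δ : ℝ} (hx : x ∈ Icc a b)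
    (hx1 : x + δ / 2 ∈ Icc a b) (hx2 : x + δ ∈ Icc a b) : HasGaussianLaw (T u x δ) P := by
  classical
  set y : Fin 3 → Icc a b := ![⟨x, hx⟩, ⟨x + δ / 2, hx1⟩, ⟨x + δ, hx2⟩] with hy
  have hI : ∀ i, y i ∈ Finset.univ.image y := fun i => Finset.mem_image_of_mem _ (Finset.mem_univ i)
  have hG := h.gaussian.hasGaussianLaw (Finset.univ.image y)
  set L : ((Finset.univ.image y) → ℝ) →L[ℝ] EuclideanSpace ℝ (Fin 3) :=
    (EuclideanSpace.equiv (Fin 3) ℝ).symm.toContinuousLinearMap.comp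
      (ContinuousLinearMap.pi fun i => ContinuousLinearMap.proj ⟨y i, hI i⟩) with hL
  have hT : T u x δ = fun ω => L ((Finset.univ.image y).restrict fun t => u t ω) := by
    funext ω
    ext i
    fin_cases i <;> simp [hL, hy, T, sample, Finset.restrict]
  rw [hT]
  exact hG.map_fun L

theorem integral_T_eq_zero (h : G1 P a b u) {x δ : ℝ} (hx : x ∈ Icc a b)
    (hx1 : x + δ / 2 ∈ Icc a b) (hx2 : x + δ ∈ Icc a b) (i : Fin 3) :
    ∫ ω, T u x δ ω i ∂P = 0 := by
  fin_cases i
  · simpa [T, sample] using h.centered x hx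
  · simpa [T, sample] using h.centered _ hx1
  · simpa [T, sample] using h.centered _ hx2

/-- The quadratic form at c is the variance of ∑ cᵢ Xᵢ. -/
theorem posSemidef_covMatrix [IsFiniteMeasure P] {X : Ω → EuclideanSpace ℝ (Fin 3)}
    (hX : ∀ i, MemLp (fun ω => X ω i) 2 P) : (covMatrix P X).PosSemidef := by
  refine Matrix.PosSemidef.of_dotProduct_mulVec_nonneg (covMatrix_isHermitian P X) fun c => ?_
  have h := variance_nonneg (fun ω => ∑ i, c i * X ω i) P
  rw [variance_fun_sum fun i => (hX i).const_mul (c i)] at h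
  refine h.trans_eq ?_
  simp only [dotProduct, Matrix.mulVec, covMatrix, Matrix.of_apply, star_trivial, Finset.mul_sum,
    covariance_const_mul_left, covariance_const_mul_right]
  refine Finset.sum_congr rfl fun i _ => Finset.sum_congr rfl fun j _ => ?_
  ring

/-- A positive semidefinite matrix with nonzero determinant is positive definite; the Gaussian law
supplies only square integrability. -/
theorem posDef_covMatrix [IsProbabilityMeasure P] {X : Ω → EuclideanSpace ℝ (Fin 3)}
    (hX : HasGaussianLaw X P) (hdet : (covMatrix P X).det ≠ 0) : (covMatrix P X).PosDef := by
  refine (posSemidef_covMatrix fun i => ?_).posDef_iff_det_ne_zero.2 hdet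
  exact (hX.map_fun (EuclideanSpace.proj i : EuclideanSpace ℝ (Fin 3) →L[ℝ] ℝ)).memLp_two

end Probability

/-! ### Projections and the main theorem -/

theorem tendsto_euclideanSpace {v : ℝ → EuclideanSpace ℝ (Fin 3)} {c : EuclideanSpace ℝ (Fin 3)}
    (h : ∀ i, IsOrder 1 fun δ => v δ i - c i) : Tendsto v (𝓝[>] 0) (𝓝 c) :=
  ((PiLp.continuous_toLp 2 fun _ : Fin 3 => ℝ).tendsto c.ofLp).comp
    (tendsto_pi_nhds.2 fun i => (h i).tendsto)

/-- The sample is A d with d the divided differences of μ, and A is moved onto v as its transpose.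
-/
theorem inner_sample {μ : ℝ → ℝ} {x δ : ℝ} (hδ : 0 < δ) (v : EuclideanSpace ℝ (Fin 3)) :
    inner ℝ (sample μ x δ) v = divDiff 0 μ x δ * (v 0 + v 1 + v 2) +
      divDiff 1 μ x δ * (δ / 2 * v 1 + δ * v 2) + divDiff 2 μ x δ * (δ ^ 2 / 4 * v 2) := by
  simp only [PiLp.inner_apply, Fin.sum_univ_three, sample, divDiff, Matrix.cons_val,
    RCLike.inner_apply, conj_trivial]
  field_simp
  ring

end CorrSamp

end

theorem lemma5p1 {Ω : Type*} [MeasurableSpace Ω] (P : Measure Ω) [IsProbabilityMeasure P]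
    (a b : ℝ) (u : ℝ → Ω → ℝ) (h1 : CorrSamp.G1 P a b u) (h2 : CorrSamp.G2 P a b u)
    (x : ℝ) (hx : x ∈ Ico a b) :
    let R : ℕ → ℕ → ℝ := fun k l => CorrSamp.diagDeriv a b (CorrSamp.corr P u) k l x
    let detR : ℝ := (CorrSamp.corrMatrix a b (CorrSamp.corr P u) x).det
    let m33 : ℝ := CorrSamp.minor33 a b (CorrSamp.corr P u) x
    let m32 : ℝ := CorrSamp.minor32 a b (CorrSamp.corr P u) x
    let m31 : ℝ := CorrSamp.minor31 a b (CorrSamp.corr P u) x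
    let C : ℝ → Matrix (Fin 3) (Fin 3) ℝ := fun δ => CorrSamp.covMatrix P (CorrSamp.T u x δ)
    let lam : Fin 3 → ℝ → ℝ := fun k δ => CorrSamp.covEigenvalue P (CorrSamp.T u x δ) k
    -- `T(δ)` is a centered Gaussian vector with positive definite covariance matrix
    (∀ᶠ δ in 𝓝[>] (0 : ℝ), HasGaussianLaw (CorrSamp.T u x δ) P ∧
      (∀ i, ∫ ω, CorrSamp.T u x δ ω i ∂P = 0) ∧ (C δ).PosDef) ∧
    -- the eigenvalues
    (∀ᶠ δ in 𝓝[>] (0 : ℝ), 0 < lam 0 δ ∧ lam 0 δ ≤ lam 1 δ ∧ lam 1 δ ≤ lam 2 δ) ∧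
    ((fun δ => lam 0 δ - detR / (96 * m33) * δ ^ 4) =O[𝓝[>] 0] fun δ => δ ^ 5) ∧
    ((fun δ => lam 1 δ - m33 / (2 * R 0 0) * δ ^ 2) =O[𝓝[>] 0] fun δ => δ ^ 3) ∧
    ((fun δ => lam 2 δ - 3 * R 0 0) =O[𝓝[>] 0] fun δ => δ) ∧
    -- the eigenvectors
    ∃ v : Fin 3 → ℝ → EuclideanSpace ℝ (Fin 3),
      (∀ᶠ δ in 𝓝[>] (0 : ℝ), Orthonormal ℝ (fun k => v k δ) ∧
        ∀ k, Matrix.toEuclideanLin (C δ) (v k δ) = lam k δ • v k δ) ∧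
      Tendsto (v 0) (𝓝[>] 0) (𝓝 ((1 / √6) • !₂[1, -2, 1])) ∧
      Tendsto (v 1) (𝓝[>] 0) (𝓝 ((1 / √2) • !₂[1, 0, -1])) ∧
      Tendsto (v 2) (𝓝[>] 0) (𝓝 ((1 / √3) • !₂[1, 1, 1])) ∧
      -- the projections of the threshold vector `τ(δ)`
      ∀ μ : ℝ → ℝ, ContDiffOn ℝ 3 μ (Icc a b) →
        let μ' : ℝ := derivWithin μ (Icc a b) x
        let μ'' : ℝ := iteratedDerivWithin 2 μ (Icc a b) x
        let τ : ℝ → EuclideanSpace ℝ (Fin 3) := fun δ => CorrSamp.sample μ x δ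
        ((fun δ => inner ℝ (τ δ) (v 0 δ) -
            (m31 * μ x - m32 * μ' + m33 * μ'') / (4 * √6 * m33) * δ ^ 2)
          =O[𝓝[>] 0] fun δ => δ ^ 3) ∧
        ((fun δ => inner ℝ (τ δ) (v 1 δ) - (R 1 0 * μ x - R 0 0 * μ') / (√2 * R 0 0) * δ)
          =O[𝓝[>] 0] fun δ => δ ^ 2) ∧
        ((fun δ => inner ℝ (τ δ) (v 2 δ) - √3 * μ x) =O[𝓝[>] 0] fun δ => δ) := by
  intro R detR m33 m32 m31 C lam
  set m : ℕ → ℕ → ℝ → ℝ := fun k l δ => CorrSamp.divDiff₂ k l (CorrSamp.corr P u) x δ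
  have hxI : x ∈ Icc a b := Ico_subset_Icc_self hx
  have hm : ∀ k ≤ 2, ∀ l ≤ 2, CorrSamp.IsOrder 1 fun δ => m k l δ - R k l := fun k hk l hl =>
    CorrSamp.isOrder_divDiff₂_sub hx h2.smooth hk hl
  have hC : ∀ δ, 0 < δ → C δ = CorrSamp.vandermondeConj (fun k l => m k l δ) (δ / 2) :=
    fun δ hδ => CorrSamp.covMatrix_T_eq hδ
  obtain ⟨hR00, h33⟩ := CorrSamp.corrMatrix_minors_pos (h2.posDef x hxI)
  have hdet : 0 < detR := (h2.posDef x hxI).det_pos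
  have e33 : m33 = R 0 0 * R 1 1 - R 1 0 * R 1 0 := by
    simp only [m33, R, CorrSamp.minor33]
    ring
  have edet : detR = R 0 0 * (R 1 1 * R 2 2 - R 2 1 * R 2 1) -
      R 1 0 * (R 1 0 * R 2 2 - R 2 1 * R 2 0) + R 2 0 * (R 1 0 * R 2 1 - R 1 1 * R 2 0) := by
    simp only [detR, R, CorrSamp.corrMatrix, Matrix.det_fin_three, Matrix.of_apply,
      Matrix.cons_val]
    ring
  have hdetO := CorrSamp.isOrder_det_vandermondeConj hm edet
  have hpd : ∀ᶠ δ in 𝓝[>] (0 : ℝ), HasGaussianLaw (CorrSamp.T u x δ) P ∧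
      (∀ i, ∫ ω, CorrSamp.T u x δ ω i ∂P = 0) ∧ (C δ).PosDef := by
    -- The rescaled determinant tends to detR/64 > 0, so C(δ) is eventually nonsingular.
    have hlow : ∀ᶠ δ in 𝓝[>] (0 : ℝ), detR / 64 / 2 ≤ (C δ).det * (δ ^ 6)⁻¹ := by
      refine CorrSamp.IsOrder.half_le (by positivity)
        (CorrSamp.IsOrder.cancel (m := 6) (hdetO.congr_pos fun δ hδ => ?_))
      rw [hC δ hδ]
      field_simp
    filter_upwards [hlow, Ioo_mem_nhdsGT (sub_pos.2 hx.2)] with δ h hδ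
    have i1 : x + δ / 2 ∈ Icc a b := ⟨by linarith [hx.1, hδ.1], by linarith [hδ.2, hδ.1]⟩
    have i2 : x + δ ∈ Icc a b := ⟨by linarith [hx.1, hδ.1], by linarith [hδ.2]⟩
    have hG := CorrSamp.hasGaussianLaw_T h1 hxI i1 i2
    refine ⟨hG, CorrSamp.integral_T_eq_zero h1 hxI i1 i2, CorrSamp.posDef_covMatrix hG ?_⟩
    intro h0
    have hc : (C δ).det = 0 := h0
    rw [hc, zero_mul] at h
    linarith
  have hlam : ∀ᶠ δ in 𝓝[>] (0 : ℝ), 0 < lam 0 δ ∧ lam 0 δ ≤ lam 1 δ ∧ lam 1 δ ≤ lam 2 δ := by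
    filter_upwards [hpd] with δ ⟨_, _, h⟩
    have hanti := (CorrSamp.covMatrix_isHermitian P (CorrSamp.T u x δ)).eigenvalues₀_antitone
    refine ⟨?_, hanti (by decide), hanti (by decide)⟩
    have hp := h.eigenvalues_pos (Fintype.equivOfCardEq (Fintype.card_fin _)
      (Fin.cast (Fintype.card_fin 3).symm (Fin.rev 0)))
    rw [Matrix.IsHermitian.eigenvalues, Equiv.symm_apply_apply] at hp
    exact hp
  have hsym (δ : ℝ) := CorrSamp.esymm_eigenvalues₀
    (CorrSamp.covMatrix_isHermitian P (CorrSamp.T u x δ)) (l := fun k => lam k δ) fun _ => rfl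
  obtain ⟨l0, l1, l2⟩ := CorrSamp.isOrder_of_esymm (d := detR) hR00 h33 hlam
    ((CorrSamp.isOrder_trace_vandermondeConj hm).congr_pos fun δ hδ => by
      rw [(hsym δ).1, ← hC δ hδ])
    ((CorrSamp.isOrder_esymm_vandermondeConj hm e33).congr_pos fun δ hδ => by
      rw [← hC δ hδ]
      linear_combination -(hsym δ).1 - (hsym δ).2.1 - (hsym δ).2.2)
    (hdetO.congr_pos fun δ hδ => by rw [(hsym δ).2.1, ← hC δ hδ])
  refine ⟨hpd, hlam, l0, l1, by simpa [CorrSamp.IsOrder] using l2, ?_⟩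
  -- The sign is fixed on a coordinate whose limit is positive: the last one for v₁, the first one
  -- for v₂ and v₃.
  choose v hvo hve hvs using fun δ => CorrSamp.exists_orthonormal_eigenvectors
    (CorrSamp.covMatrix_isHermitian P (CorrSamp.T u x δ)) ![2, 0, 0]
  have hE (k : Fin 3) := CorrSamp.isEigenpair_of_vandermondeConj (m := m) (lam := lam k)
    (v := fun δ => v δ k) hC (fun δ => (hvo δ).1 k) fun δ => hve δ k
  have O4 : CorrSamp.IsOrder 4 (lam 0) :=
    ((l0.mono (by norm_num)).add ((CorrSamp.IsOrder.pow 4).const_mul _)).congr_pos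
      fun δ _ => sub_add_cancel _ _
  have O2 : CorrSamp.IsOrder 2 (lam 1) :=
    ((l1.mono (by norm_num)).add ((CorrSamp.IsOrder.pow 2).const_mul _)).congr_pos
      fun δ _ => sub_add_cancel _ _
  obtain ⟨a0, a1, a2, a3⟩ := (hE 0).smallest (m32 := m32) (m31 := m31) hm e33 rfl rfl h33 O4
    fun δ => hvs δ 0
  obtain ⟨b0, b1, b2, b3⟩ := (hE 1).middle hm hR00 O2 (fun δ => hvs δ 1) a0 <|
    Eventually.of_forall fun δ => by
      have h := (hvo δ).2 (show (1 : Fin 3) ≠ 0 by decide)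
      simpa [PiLp.inner_apply, Fin.sum_univ_three] using h
  obtain ⟨c0, c1, c2, c3⟩ := (hE 2).largest hm hR00 l2 fun δ => hvs δ 2
  refine ⟨fun k δ => v δ k, Eventually.of_forall fun δ => ⟨hvo δ, hve δ⟩, ?_, ?_, ?_, ?_⟩
  · refine CorrSamp.tendsto_euclideanSpace fun i => ?_
    fin_cases i
    · simpa using a0.1
    · simpa [div_eq_inv_mul] using a0.2.1
    · simpa using a0.2.2
  · refine CorrSamp.tendsto_euclideanSpace fun i => ?_
    fin_cases i
    · simpa using b0.1
    · simpa using b0.2.1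
    · simpa [div_eq_inv_mul] using b0.2.2
  · refine CorrSamp.tendsto_euclideanSpace fun i => ?_
    fin_cases i
    · simpa using c0.1
    · simpa using c0.2.1
    · simpa using c0.2.2
  intro μ hμ μ' μ'' τ
  have hu : UniqueDiffOn ℝ (Icc a b) := uniqueDiffOn_Icc (hx.1.trans_lt hx.2)
  have d0 : CorrSamp.IsOrder 1 fun δ => CorrSamp.divDiff 0 μ x δ - μ x := by
    simpa using CorrSamp.isOrder_divDiff_sub hx hμ (Nat.zero_le 2)
  have d1 : CorrSamp.IsOrder 1 fun δ => CorrSamp.divDiff 1 μ x δ - μ' := by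
    simpa using CorrSamp.isOrder_divDiff_sub hx hμ one_le_two
  have d2 : CorrSamp.IsOrder 1 fun δ => CorrSamp.divDiff 2 μ x δ - μ'' :=
    CorrSamp.isOrder_divDiff_sub hx hμ le_rfl
  have h33' : m33 ≠ 0 := h33.ne'
  have hR00' : R 0 0 ≠ 0 := hR00.ne'
  refine ⟨?_, ?_, ?_⟩
  -- With w_k ≈ c_k δ², each error splits as d_k w_k - c_k δ² μ⁽ᵏ⁾ = d_k (w_k - c_k δ²) + c_k δ²
  -- (d_k - μ⁽ᵏ⁾); the other two projections are handled likewise.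
  · have t := (((d0.bounded.mul a1).add (d1.bounded.mul a2)).add (d2.bounded.mul a3)).add
      ((((CorrSamp.IsOrder.pow 2).mul d0).const_mul (m31 / (4 * √6 * m33))).add
      ((((CorrSamp.IsOrder.pow 2).mul d1).const_mul (-m32 / (4 * √6 * m33))).add
      (((CorrSamp.IsOrder.pow 2).mul d2).const_mul (1 / (4 * √6)))))
    refine t.congr_pos fun δ hδ => ?_
    simp only [τ, CorrSamp.inner_sample hδ]
    field_simp
    ring
  · have t := (((d0.bounded.mul b1).add (d1.bounded.mul b2)).add (d2.bounded.mul b3)).add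
      (((CorrSamp.IsOrder.id.mul d0).const_mul (R 1 0 / (√2 * R 0 0))).add
      ((CorrSamp.IsOrder.id.mul d1).const_mul (-1 / √2)))
    refine t.congr_pos fun δ hδ => ?_
    simp only [τ, CorrSamp.inner_sample hδ]
    field_simp
    ring
  · have t := (((d0.bounded.mul c1).add (d1.bounded.mul c2)).add (d2.bounded.mul c3)).add
      (d0.const_mul √3)
    have t' := t.congr_pos (g := fun δ => inner ℝ (τ δ) (v δ 2) - √3 * μ x) fun δ hδ => by
      simp only [τ, CorrSamp.inner_sample hδ]
      ring
    simpa [CorrSamp.IsOrder] using t'
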